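/- There are \(n\ge 2\) identical firms with zero marginal cost and one consumer with unit demand and outside option \(0\). The match values \(x_i\in\{0,1\}\) are i.i.d. with \(\mathbb P(x_i=1)=\mu\in(0,1)\), the search cost is \(c\in[0,\mu)\), and \(M\) is a nonempty measurable space of messages. Firms simultaneously post prices \(p_i\ge 0\) (possibly mixing, independently of their match values) and, for its privately known match value, each type of each firm chooses a distribution over messages in \(M\), which may depend on its price; the firm's message is revealed to the consumer only when she visits the firm (cheap talk, no commitment). The consumer observes all prices and then searches sequentially with costless recall: after any history she may visit an unvisited firm at cost \(c\), buy from a visited firm, or take the outside option. If she buys from firm \(i\) after \(k\) visits, she gets \(x_i-p_i-kc\), firm \(i\) gets \(p_i\) and the other firms get \(0\); if she takes the outside option she gets \(-kc\) and all firms get \(0\). A symmetric equilibrium is a weak perfect Bayesian equilibrium in which all firms use the same strategy. No type of any firm gains by deviating to another price and message. The consumer's search is sequentially rational after every history. At every price of a firm, on or off the path, she holds a conjecture about that firm's messaging strategy; it is correct at almost every price posted in equilibrium; given the conjecture, her posterior about the firm after its message follows from the prior \(\mu\) by Bayes' rule (so a price alone conveys nothing about the match value). Her beliefs about a firm depend only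 on that firm's own price and message ("no signaling what you don't know"). A distribution \(F\) of the posterior probability that \(x_i=1\) provides useless information if its support is contained in \([\mu-c,1]\). A reservation value for \((F,p)\) is a solution \(U\) of \(c=\int_{U+p}^1(x-p-U)\,dF(x)\), and the effective value is \(\min\{x-p,U\}\) with \(x\sim F\). Then there is an essentially unique symmetric equilibrium, and in it firms provide useless information and charge price \(0\). That is, a symmetric equilibrium exists, and in every symmetric equilibrium each firm posts the price \(0\) with probability one, the distribution \(F\) of the consumer's posterior about each firm provides useless information, \(\mu-c\) is a reservation value for \((F,0)\), and for every reservation value for \((F,0)\) the effective value equals \(\mu-c\) with probability one. -/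

import Mathlib

open MeasureTheory ProbabilityTheory
open scoped NNReal ENNReal

noncomputable section

/-- A behavioural search strategy of a consumer facing `n` firms with messages in `M`.
The arguments are the posted prices, the list of firms visited so far (most recent first), and a
message profile, of which only the entries of the visited firms may be used.
`visit` and `buy` are the probabilities of visiting a firm next and of stopping to buy from it;
with the remaining probability the consumer stops and takes the outside option. -/
structure SearchStrategy (n : ℕ) (M : Type*) [MeasurableSpace M] where
  visit : (Fin n → ℝ≥0) → List (Fin n) → (Fin n → M) → Fin n → ℝ≥0
  buy : (Fin n → ℝ≥0) → List (Fin n) → (Fin n → M) → Fin n → ℝ≥0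
  sum_le_one : ∀ p L m, ∑ i, visit p L m i + ∑ i, buy p L m i ≤ 1
  visit_visited : ∀ p L m, ∀ i ∈ L, visit p L m i = 0
  buy_unvisited : ∀ p L m, ∀ i ∉ L, buy p L m i = 0
  visit_adapted : ∀ p L m m', (∀ i ∈ L, m i = m' i) → visit p L m = visit p L m'
  buy_adapted : ∀ p L m m', (∀ i ∈ L, m i = m' i) → buy p L m = buy p L m'
  measurable_visit : ∀ L i,
    Measurable (fun z : (Fin n → ℝ≥0) × (Fin n → M) => visit z.1 L z.2 i)
  measurable_buy : ∀ L i,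
    Measurable (fun z : (Fin n → ℝ≥0) × (Fin n → M) => buy z.1 L z.2 i)

/-- The probability that the consumer ends up buying from firm `i`, from the point at which the
firms in `L` have been visited and at most `k` further visits can be made; `m i` is the message
that firm `i` reveals if it is visited. -/
def SearchStrategy.buyProb {n : ℕ} {M : Type*} [MeasurableSpace M] (s : SearchStrategy n M)
    (i : Fin n) (p : Fin n → ℝ≥0) (m : Fin n → M) : ℕ → List (Fin n) → ℝ≥0
  | 0, L => s.buy p L m i
  | k + 1, L => s.buy p L m i + ∑ j, s.visit p L m j * s.buyProb i p m k (j :: L)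

/-- The prior law of a match value: `true` (value 1) with probability `μ`, `false` (value 0)
with probability `1 - μ`. -/
def typeLaw (μ : ℝ) : Measure Bool :=
  ENNReal.ofReal μ • Measure.dirac true + ENNReal.ofReal (1 - μ) • Measure.dirac false

/-- The law of the message of a firm with price `q` whose types send messages according to `σ`. -/
def messageLaw {M : Type*} [MeasurableSpace M] (μ : ℝ) (σ : Kernel (ℝ≥0 × Bool) M) (q : ℝ≥0) :
    Measure M :=
  ENNReal.ofReal μ • σ (q, true) + ENNReal.ofReal (1 - μ) • σ (q, false)

/-- The consumer's expected continuation payoff (past search costs being sunk), when the firms in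
`L` have been visited, have revealed the messages `m`, and at most `k` further visits can be made.
`belief i q a` is the probability that firm `i` has match value 1 given its price `q` and message
`a`; `conj i` is the conjectured messaging strategy of firm `i`. -/
def SearchStrategy.payoff {n : ℕ} {M : Type*} [MeasurableSpace M] (s : SearchStrategy n M)
    (μ c : ℝ) (conj : Fin n → Kernel (ℝ≥0 × Bool) M) (belief : Fin n → ℝ≥0 → M → ℝ)
    (p : Fin n → ℝ≥0) : ℕ → List (Fin n) → (Fin n → M) → ℝ
  | 0, L, m => ∑ i, (s.buy p L m i : ℝ) * (belief i (p i) (m i) - p i)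
  | k + 1, L, m =>
      ∑ i, (s.buy p L m i : ℝ) * (belief i (p i) (m i) - p i) +
      ∑ j, (s.visit p L m j : ℝ) *
        (-c + ∫ a, s.payoff μ c conj belief p k (j :: L) (Function.update m j a)
          ∂(messageLaw μ (conj j) (p j)))

/-- An assessment in which all firms use the same strategy: a law `priceLaw` of the posted price,
and messages drawn from `message (q, x)` by the type `x` of a firm that posted the price `q`.
The consumer has a conjecture `conj i` about the messaging of firm `i` at every price (on or off
the path), a posterior belief about the match value of firm `i` as a function of that firm's own
price and message only, and a search strategy. -/
structure SymmetricAssessment (n : ℕ) (M : Type*) [MeasurableSpace M] where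
  priceLaw : Measure ℝ≥0
  isProb_priceLaw : IsProbabilityMeasure priceLaw
  message : Kernel (ℝ≥0 × Bool) M
  isMarkov_message : IsMarkovKernel message
  conj : Fin n → Kernel (ℝ≥0 × Bool) M
  isMarkov_conj : ∀ i, IsMarkovKernel (conj i)
  belief : Fin n → ℝ≥0 → M → ℝ
  belief_mem : ∀ i q a, belief i q a ∈ Set.Icc (0 : ℝ) 1
  measurable_belief : ∀ i, Measurable (fun z : ℝ≥0 × M => belief i z.1 z.2)
  search : SearchStrategy n M

namespace SymmetricAssessment

variable {n : ℕ} {M : Type*} [MeasurableSpace M]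

/-- The law of the pair (price, message) of a firm that follows the common strategy. The price is
drawn independently of the firm's type. -/
def playLaw (A : SymmetricAssessment n M) (μ : ℝ) : Measure (ℝ≥0 × M) :=
  ((A.priceLaw.prod (typeLaw μ)) ⊗ₘ A.message).map (fun z => (z.1.1, z.2))

/-- The probability that firm `i` sells if it posts the price `q` and sends the message `a`, while
all other firms independently follow the common strategy. (Coordinate `i` of the profile `ω` is
overwritten.) -/
def saleProb (A : SymmetricAssessment n M) (μ : ℝ) (i : Fin n) (q : ℝ≥0) (a : M) : ℝ≥0∞ :=
  ∫⁻ ω, (A.search.buyProb i (Function.update (fun j => (ω j).1) i q)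
      (Function.update (fun j => (ω j).2) i a) n [] : ℝ≥0∞)
    ∂(Measure.pi (fun _ : Fin n => A.playLaw μ))

/-- The expected profit of type `x` of firm `i` when all firms follow the common strategy. -/
def profit (A : SymmetricAssessment n M) (μ : ℝ) (i : Fin n) (x : Bool) : ℝ≥0∞ :=
  ∫⁻ q, ∫⁻ a, (q : ℝ≥0∞) * A.saleProb μ i q a ∂(A.message (q, x)) ∂A.priceLaw

/-- The law of the consumer's posterior about firm `i` when that firm posts the price `q` and
messages according to the common strategy. -/
def posteriorLaw (A : SymmetricAssessment n M) (μ : ℝ) (i : Fin n) (q : ℝ≥0) : Measure ℝ :=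
  (messageLaw μ A.message q).map (A.belief i q)

/-- Symmetric weak perfect Bayesian equilibrium with "no signaling what you don't know". -/
structure IsEquilibrium (A : SymmetricAssessment n M) (μ c : ℝ) : Prop where
  /-- Conjectures about messaging are correct at the prices that are posted in equilibrium. -/
  conj_correct : ∀ i, ∀ᵐ q ∂A.priceLaw, ∀ x, A.conj i (q, x) = A.message (q, x)
  /-- At every price, the posterior follows by Bayes' rule from the prior and the conjecture. -/
  bayes : ∀ i q, ∀ S : Set M, MeasurableSet S →
    ∫ a in S, A.belief i q a ∂(messageLaw μ (A.conj i) q) = μ * (A.conj i (q, true)).real S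
  /-- The consumer's search strategy is sequentially rational after every history. -/
  consumer_optimal : ∀ (t : SearchStrategy n M) (p : Fin n → ℝ≥0) (L : List (Fin n))
    (m : Fin n → M), L.Nodup →
    t.payoff μ c A.conj A.belief p (n - L.length) L m ≤
      A.search.payoff μ c A.conj A.belief p (n - L.length) L m
  /-- No type of any firm gains by deviating to another price and message. -/
  firm_optimal : ∀ (i : Fin n) (x : Bool) (q : ℝ≥0) (a : M),
    (q : ℝ≥0∞) * A.saleProb μ i q a ≤ A.profit μ i x

end SymmetricAssessment

/-- A distribution over posteriors provides useless information if its support is contained in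
`[μ - c, 1]`. -/
def UselessInformation (μ c : ℝ) (F : Measure ℝ) : Prop :=
  F.support ⊆ Set.Icc (μ - c) 1

/-- `U` is a reservation value of a firm with posterior distribution `F` and price `q`.
(It is unique if `c > 0`.) -/
def IsReservationValue (c : ℝ) (F : Measure ℝ) (q : ℝ≥0) (U : ℝ) : Prop :=
  c = ∫ x in Set.Icc (U + q) 1, (x - q - U) ∂F

/-- The law of the effective value `min (x - q) U`. -/
def effectiveLaw (F : Measure ℝ) (q : ℝ≥0) (U : ℝ) : Measure ℝ :=
  F.map (fun x => min (x - q) U)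

end

/-! Consumer side. Search costs can be amortized: instead of the cost `c`, charge for a visit the
excess `(v - U)⁺` of the firm's net value `v` over its reservation value `U`. This excess has mean
`c`, so expected payoffs do not change. Under this accounting a strategy earns at most the effective
value `min v U` of the firm it buys from, while Weitzman's index strategy earns the maximum of `0`
and all effective values. An optimal consumer therefore almost surely buys at the highest
nonnegative effective value (`sum_buyProb_mul_eq_of_optimal`, `ae_buysBest`), and firms compete in
effective values. As `min v U = v - (v - U)⁺`, the effective value at price `q` has mean `μ - c -
q`, whatever the firm's messages (`integral_effectiveValue`).

Firm side. The sale probability depends on price and message but not on the type, so both types earn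
the same, and almost every posted price and message earns exactly this profit
(`ae_mul_saleProb_eq`). Suppose that it is positive. If a message had effective value below the mean
`μ - c - q`, the firm could raise its price slightly, send a message that is at least average there,
and sell at least as often. Hence the effective value is `μ - c - q` almost surely
(`ae_firmValue_eq_of_profit_ne_zero`), the consumer compares prices only, and Bertrand competition
excludes positive profits (`profit_eq_zero`).

With zero profits, a firm charging a small `ε` and sending a message of effective value at least `μ
- c - ε` must almost never sell, so effective values are at least `μ - c` almost surely
(`ae_le_firmValue_of_profit_eq_zero`). Their mean being `μ - c - q`, the price is `0`, and
posteriors, which dominate effective values, lie in `[μ - c, 1]`.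

Existence: all firms post `0` and babble; a firm with a positive price is never visited. -/

noncomputable section

/-! ### Search strategies and amortized search costs. -/

namespace SearchStrategy

variable {n : ℕ} {M : Type*} [MeasurableSpace M]

lemma measurable_buyProb (s : SearchStrategy n M) (i : Fin n) (k : ℕ) (L : List (Fin n)) :
    Measurable (fun z : (Fin n → ℝ≥0) × (Fin n → M) => s.buyProb i z.1 z.2 k L) := by
  induction k generalizing L with
  | zero => exact s.measurable_buy L i
  | succ k ih =>
    exact (s.measurable_buy L i).add
      (Finset.measurable_sum _ fun j _ => (s.measurable_visit L j).mul (ih (j :: L)))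

lemma sum_buyProb_le_one (s : SearchStrategy n M) (p : Fin n → ℝ≥0) (m : Fin n → M) (k : ℕ)
    (L : List (Fin n)) : ∑ i, s.buyProb i p m k L ≤ 1 := by
  induction k generalizing L with
  | zero => exact (le_add_of_nonneg_left zero_le).trans (s.sum_le_one p L m)
  | succ k ih =>
    simp only [buyProb, Finset.sum_add_distrib]
    rw [Finset.sum_comm]
    refine le_trans ?_ (s.sum_le_one p L m)
    rw [add_comm]
    gcongr with j
    rw [← Finset.mul_sum]
    exact mul_le_of_le_one_right zero_le (ih _)

lemma buyProb_le_one (s : SearchStrategy n M) (i : Fin n) (p : Fin n → ℝ≥0) (m : Fin n → M)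
    (k : ℕ) (L : List (Fin n)) : s.buyProb i p m k L ≤ 1 :=
  (Finset.single_le_sum (f := fun i => s.buyProb i p m k L) (fun _ _ => zero_le)
    (Finset.mem_univ i)).trans (s.sum_buyProb_le_one p m k L)

lemma buy_le_one (s : SearchStrategy n M) (p : Fin n → ℝ≥0) (L : List (Fin n)) (m : Fin n → M)
    (i : Fin n) : s.buy p L m i ≤ 1 :=
  (Finset.single_le_sum (f := fun i => s.buy p L m i) (fun _ _ => zero_le)
    (Finset.mem_univ i)).trans ((le_add_of_nonneg_left zero_le).trans (s.sum_le_one p L m))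

lemma visit_le_one (s : SearchStrategy n M) (p : Fin n → ℝ≥0) (L : List (Fin n)) (m : Fin n → M)
    (i : Fin n) : s.visit p L m i ≤ 1 :=
  (Finset.single_le_sum (f := fun i => s.visit p L m i) (fun _ _ => zero_le)
    (Finset.mem_univ i)).trans ((le_add_of_nonneg_right zero_le).trans (s.sum_le_one p L m))

/-- The consumer's payoff along a fixed message profile when the cost of visiting firm `j` is
replaced by `(v j - U j)⁺`, the part of its value above its reservation value. -/
def amortizedPayoff (s : SearchStrategy n M) (v : Fin n → M → ℝ) (U : Fin n → ℝ)
    (p : Fin n → ℝ≥0) : ℕ → List (Fin n) → (Fin n → M) → ℝ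
  | 0, L, m => ∑ i, (s.buy p L m i : ℝ) * v i (m i)
  | k + 1, L, m => ∑ i, (s.buy p L m i : ℝ) * v i (m i) +
      ∑ j, (s.visit p L m j : ℝ) *
        (s.amortizedPayoff v U p k (j :: L) m - max (v j (m j) - U j) 0)

/-- A visited firm contributes at most its value, any other firm at most its effective value. -/
lemma amortizedPayoff_le (s : SearchStrategy n M) (v : Fin n → M → ℝ) (U : Fin n → ℝ)
    (p : Fin n → ℝ≥0) (m : Fin n → M) (k : ℕ) (L : List (Fin n)) :
    s.amortizedPayoff v U p k L m ≤
      ∑ i, (s.buyProb i p m k L : ℝ) * if i ∈ L then v i (m i) else min (v i (m i)) (U i) := by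
  have hbuy : ∀ L i, (s.buy p L m i : ℝ) * v i (m i) =
      s.buy p L m i * if i ∈ L then v i (m i) else min (v i (m i)) (U i) := by
    intro L i
    by_cases hi : i ∈ L
    · simp [hi]
    · simp [s.buy_unvisited p L m i hi]
  induction k generalizing L with
  | zero => exact (Finset.sum_congr rfl fun i _ => hbuy L i).le
  | succ k ih =>
    simp only [amortizedPayoff, buyProb, NNReal.coe_add, NNReal.coe_sum, NNReal.coe_mul, add_mul,
      Finset.sum_add_distrib]
    rw [Finset.sum_congr rfl fun i _ => hbuy L i]
    refine add_le_add le_rfl ?_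
    simp only [Finset.sum_mul]
    rw [Finset.sum_comm]
    gcongr with j
    simp only [mul_assoc]
    rw [← Finset.mul_sum]
    by_cases hj : j ∈ L
    · simp [s.visit_visited p L m j hj]
    gcongr
    have h1 := ih (j :: L)
    -- Visiting `j` replaces its effective value by its full value; the difference is the excess
    -- over `U j`.
    have h2 : ∑ i, (s.buyProb i p m k (j :: L) : ℝ) *
          (if i ∈ j :: L then v i (m i) else min (v i (m i)) (U i)) =
        ∑ i, ((s.buyProb i p m k (j :: L) : ℝ) *
          (if i ∈ L then v i (m i) else min (v i (m i)) (U i)) +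
          if i = j then (s.buyProb j p m k (j :: L) : ℝ) * max (v j (m j) - U j) 0 else 0) := by
      refine Finset.sum_congr rfl fun i _ => ?_
      by_cases hij : i = j
      · subst hij
        simp only [List.mem_cons, true_or, if_true, hj, if_false]
        rw [← mul_add]
        congr 1
        rcases le_total (v i (m i)) (U i) with h | h
        · rw [min_eq_left h, max_eq_right (by linarith)]; ring
        · rw [min_eq_right h, max_eq_left (by linarith)]; ring
      · simp [hij]
    rw [h2, Finset.sum_add_distrib, Finset.sum_ite_eq' Finset.univ j] at h1
    simp only [Finset.mem_univ, if_true] at h1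
    -- The excess is charged in full at the visit, but recovered only with the probability of buying
    -- from `j`.
    have h3 : (s.buyProb j p m k (j :: L) : ℝ) ≤ 1 := by exact_mod_cast s.buyProb_le_one j p m k _
    nlinarith [le_max_right (v j (m j) - U j) 0]

end SearchStrategy

/-! ### Weitzman's index strategy. -/

/-- `i` is the first index at which `y` attains its maximum. -/
def IsFirstMax {n : ℕ} (y : Fin n → ℝ) (i : Fin n) : Prop :=
  (∀ j, y j ≤ y i) ∧ ∀ j < i, y j < y i

lemma IsFirstMax.unique {n : ℕ} {y : Fin n → ℝ} {i j : Fin n} (hi : IsFirstMax y i)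
    (hj : IsFirstMax y j) : i = j := by
  rcases lt_trichotomy i j with h | h | h
  · exact absurd (hj.2 i h) (not_lt.2 (hi.1 j))
  · exact h
  · exact absurd (hi.2 j h) (not_lt.2 (hj.1 i))

lemma exists_isFirstMax {n : ℕ} (hn : 0 < n) (y : Fin n → ℝ) : ∃ i, IsFirstMax y i := by
  classical
  have : Nonempty (Fin n) := ⟨⟨0, hn⟩⟩
  obtain ⟨i₀, -, h₀⟩ := Finset.exists_max_image Finset.univ y Finset.univ_nonempty
  let S := Finset.univ.filter fun i => ∀ j, y j ≤ y i
  have hS : S.Nonempty := ⟨i₀, by simpa [S] using h₀⟩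
  have hmin := S.min'_mem hS
  simp only [S, Finset.mem_filter, Finset.mem_univ, true_and] at hmin
  refine ⟨S.min' hS, hmin, fun j hj => lt_of_le_of_ne (hmin j) fun h => ?_⟩
  have : j ∈ S := by simpa [S, h] using hmin
  exact absurd (S.min'_le j this) (not_le.2 hj)

lemma measurableSet_isFirstMax {n : ℕ} {α : Type*} [MeasurableSpace α] {y : α → Fin n → ℝ}
    (hy : ∀ i, Measurable fun a => y a i) (i : Fin n) :
    MeasurableSet {a | IsFirstMax (y a) i} := by
  simp only [IsFirstMax, Set.ofPred_and, Set.ofPred_forall]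
  exact (MeasurableSet.iInter fun j => measurableSet_le (hy j) (hy i)).inter
    (MeasurableSet.iInter fun j => MeasurableSet.iInter fun _ => measurableSet_lt (hy j) (hy i))

section IndexStrategy

variable {n : ℕ} {M : Type*}

/-- The current index of firm `i`: its value once visited, its reservation value before. -/
def searchIndex (v : Fin n → ℝ≥0 → M → ℝ) (U : Fin n → ℝ≥0 → ℝ) (p : Fin n → ℝ≥0)
    (L : List (Fin n)) (m : Fin n → M) (i : Fin n) : ℝ :=
  if i ∈ L then v i (p i) (m i) else U i (p i)

lemma searchIndex_congr (v : Fin n → ℝ≥0 → M → ℝ) (U : Fin n → ℝ≥0 → ℝ) (p : Fin n → ℝ≥0)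
    (L : List (Fin n)) {m m' : Fin n → M} (h : ∀ i ∈ L, m i = m' i) :
    searchIndex v U p L m = searchIndex v U p L m' := by
  funext i
  by_cases hi : i ∈ L
  · simp [searchIndex, hi, h i hi]
  · simp [searchIndex, hi]

variable [MeasurableSpace M]

lemma measurable_searchIndex {v : Fin n → ℝ≥0 → M → ℝ} {U : Fin n → ℝ≥0 → ℝ}
    (hv : ∀ i, Measurable fun z : ℝ≥0 × M => v i z.1 z.2) (hU : ∀ i, Measurable (U i))
    (L : List (Fin n)) (i : Fin n) :
    Measurable fun z : (Fin n → ℝ≥0) × (Fin n → M) => searchIndex v U z.1 L z.2 i := by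
  by_cases hi : i ∈ L
  · simp only [searchIndex, hi, if_true]
    exact (hv i).comp (f := fun z : (Fin n → ℝ≥0) × (Fin n → M) => (z.1 i, z.2 i)) (by fun_prop)
  · simp only [searchIndex, hi, if_false]
    exact (hU i).comp (by fun_prop)

open Classical in
/-- Weitzman's index strategy: turn to the firm with the highest index, visiting it or buying from
it, and stop when no index is positive. -/
def indexStrategy (v : Fin n → ℝ≥0 → M → ℝ) (U : Fin n → ℝ≥0 → ℝ)
    (hv : ∀ i, Measurable fun z : ℝ≥0 × M => v i z.1 z.2) (hU : ∀ i, Measurable (U i)) :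
    SearchStrategy n M where
  visit p L m i :=
    if i ∉ L ∧ 0 < searchIndex v U p L m i ∧ IsFirstMax (searchIndex v U p L m) i then 1 else 0
  buy p L m i :=
    if i ∈ L ∧ 0 < searchIndex v U p L m i ∧ IsFirstMax (searchIndex v U p L m) i then 1 else 0
  sum_le_one p L m := by
    rw [← Finset.sum_add_distrib]
    by_cases h : ∃ i, IsFirstMax (searchIndex v U p L m) i
    · obtain ⟨i, hi⟩ := h
      rw [Finset.sum_eq_single i]
      · by_cases hL : i ∈ L <;> simp [hL] <;> split_ifs <;> simp
      · intro j _ hj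
        have : ¬ IsFirstMax (searchIndex v U p L m) j := fun h => hj (h.unique hi)
        simp [this]
      · simp
    · push Not at h
      simp [h]
  visit_visited p L m i hi := by simp [hi]
  buy_unvisited p L m i hi := by simp [hi]
  visit_adapted p L m m' h := by simp only [searchIndex_congr v U p L h]
  buy_adapted p L m m' h := by simp only [searchIndex_congr v U p L h]
  measurable_visit L i := by
    refine Measurable.ite ?_ measurable_const measurable_const
    exact (MeasurableSet.const _).inter
      ((measurableSet_lt measurable_const (measurable_searchIndex hv hU L i)).inter
        (measurableSet_isFirstMax (measurable_searchIndex hv hU L) i))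
  measurable_buy L i := by
    refine Measurable.ite ?_ measurable_const measurable_const
    exact (MeasurableSet.const _).inter
      ((measurableSet_lt measurable_const (measurable_searchIndex hv hU L i)).inter
        (measurableSet_isFirstMax (measurable_searchIndex hv hU L) i))

variable {v : Fin n → ℝ≥0 → M → ℝ} {U : Fin n → ℝ≥0 → ℝ}
  {hv : ∀ i, Measurable fun z : ℝ≥0 × M => v i z.1 z.2} {hU : ∀ i, Measurable (U i)}

/-- At every history the index strategy stops, buys from or visits a firm of highest index. -/
lemma indexStrategy_cases (hn : 0 < n) (p : Fin n → ℝ≥0) (L : List (Fin n)) (m : Fin n → M) :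
    ((∀ j, searchIndex v U p L m j ≤ 0) ∧
      (indexStrategy v U hv hU).visit p L m = 0 ∧ (indexStrategy v U hv hU).buy p L m = 0) ∨
    ∃ i, 0 < searchIndex v U p L m i ∧ (∀ j, searchIndex v U p L m j ≤ searchIndex v U p L m i) ∧
      ((i ∈ L ∧ (indexStrategy v U hv hU).visit p L m = 0 ∧
        (indexStrategy v U hv hU).buy p L m = Pi.single i 1) ∨
      (i ∉ L ∧ (indexStrategy v U hv hU).visit p L m = Pi.single i 1 ∧
        (indexStrategy v U hv hU).buy p L m = 0)) := by
  obtain ⟨i, hi⟩ := exists_isFirstMax hn (searchIndex v U p L m)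
  have hne : ∀ j, j ≠ i → ¬ IsFirstMax (searchIndex v U p L m) j := fun j hj h => hj (h.unique hi)
  by_cases h0 : 0 < searchIndex v U p L m i
  · refine Or.inr ⟨i, h0, hi.1, ?_⟩
    by_cases hL : i ∈ L
    · refine Or.inl ⟨hL, ?_, ?_⟩ <;> funext j <;> by_cases hj : j = i
      · subst hj; simp [indexStrategy, hL]
      · simp [indexStrategy, hne j hj]
      · subst hj; simp [indexStrategy, hL, h0, hi]
      · simp [indexStrategy, hne j hj, hj]
    · refine Or.inr ⟨hL, ?_, ?_⟩ <;> funext j <;> by_cases hj : j = i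
      · subst hj; simp [indexStrategy, hL, h0, hi]
      · simp [indexStrategy, hne j hj, hj]
      · subst hj; simp [indexStrategy, hL]
      · simp [indexStrategy, hne j hj]
  · refine Or.inl ⟨fun j => (hi.1 j).trans (not_lt.1 h0), ?_, ?_⟩ <;> funext j <;>
      by_cases hj : j = i
    · subst hj; simp [indexStrategy, h0]
    · simp [indexStrategy, hne j hj]
    · subst hj; simp [indexStrategy, h0]
    · simp [indexStrategy, hne j hj]

/-- The index strategy attains the highest effective value. -/
lemma fold_le_amortizedPayoff_indexStrategy (hn : 0 < n) (p : Fin n → ℝ≥0) (m : Fin n → M) (k : ℕ)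
    (L : List (Fin n)) (hL : L.Nodup) (hk : k + L.length = n) :
    Finset.univ.fold max 0 (fun i => if i ∈ L then v i (p i) (m i)
        else min (v i (p i) (m i)) (U i (p i))) ≤
      (indexStrategy v U hv hU).amortizedPayoff (fun i => v i (p i)) (fun i => U i (p i)) p k L m := by
  have hmin : ∀ L i, (if i ∈ L then v i (p i) (m i) else min (v i (p i) (m i)) (U i (p i))) ≤
      searchIndex v U p L m i := by
    intro L i
    unfold searchIndex
    split_ifs
    · exact le_rfl
    · exact min_le_right _ _
  induction k generalizing L with
  | zero =>
    -- With no visits left, `hk` forces every firm to have been visited, so the index strategy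
    -- cannot call for a visit.
    have hall : ∀ i, i ∈ L := by
      have h1 : L.toFinset = Finset.univ := by
        rw [← Finset.card_eq_iff_eq_univ, List.toFinset_card_of_nodup hL, Fintype.card_fin]
        omega
      intro i
      rw [← List.mem_toFinset, h1]
      exact Finset.mem_univ i
    rcases indexStrategy_cases (hv := hv) (hU := hU) hn p L m with
      ⟨h0, -, hb⟩ | ⟨i, h0, hi, ⟨hiL, -, hb⟩ | ⟨hiL, -, hb⟩⟩
    · simp only [SearchStrategy.amortizedPayoff, hb]
      simp only [Pi.zero_apply, NNReal.coe_zero, zero_mul, Finset.sum_const_zero]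
      exact (Finset.fold_max_le _).2 ⟨le_rfl, fun i _ => (hmin L i).trans (h0 i)⟩
    · have hval : searchIndex v U p L m i = v i (p i) (m i) := by simp [searchIndex, hiL]
      have : (indexStrategy v U hv hU).amortizedPayoff (fun i => v i (p i)) (fun i => U i (p i))
          p 0 L m = v i (p i) (m i) := by
        simp only [SearchStrategy.amortizedPayoff, hb]
        rw [Finset.sum_eq_single i (fun j _ hj => by simp [hj]) (by simp)]
        simp
      rw [this, ← hval]
      exact (Finset.fold_max_le _).2 ⟨h0.le, fun j _ => (hmin L j).trans (hi j)⟩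
    · exact absurd (hall i) hiL
  | succ k ih =>
    rcases indexStrategy_cases (hv := hv) (hU := hU) hn p L m with
      ⟨h0, hvis, hb⟩ | ⟨i, h0, hi, ⟨hiL, hvis, hb⟩ | ⟨hiL, hvis, hb⟩⟩
    · simp only [SearchStrategy.amortizedPayoff, hb, hvis]
      simp only [Pi.zero_apply, NNReal.coe_zero, zero_mul, Finset.sum_const_zero, add_zero]
      exact (Finset.fold_max_le _).2 ⟨le_rfl, fun i _ => (hmin L i).trans (h0 i)⟩
    · have hval : searchIndex v U p L m i = v i (p i) (m i) := by simp [searchIndex, hiL]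
      have : (indexStrategy v U hv hU).amortizedPayoff (fun i => v i (p i)) (fun i => U i (p i))
          p (k + 1) L m = v i (p i) (m i) := by
        simp only [SearchStrategy.amortizedPayoff, hb, hvis]
        rw [Finset.sum_eq_single i (fun j _ hj => by simp [hj]) (by simp)]
        simp
      rw [this, ← hval]
      exact (Finset.fold_max_le _).2 ⟨h0.le, fun j _ => (hmin L j).trans (hi j)⟩
    · have hval : searchIndex v U p L m i = U i (p i) := by simp [searchIndex, hiL]
      have : (indexStrategy v U hv hU).amortizedPayoff (fun i => v i (p i)) (fun i => U i (p i))
          p (k + 1) L m =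
          (indexStrategy v U hv hU).amortizedPayoff (fun i => v i (p i)) (fun i => U i (p i))
            p k (i :: L) m - max (v i (p i) (m i) - U i (p i)) 0 := by
        simp only [SearchStrategy.amortizedPayoff, hb, hvis]
        rw [Finset.sum_eq_single (a := i) (s := Finset.univ)
          (f := fun j => ((Pi.single i 1 : Fin n → ℝ≥0) j : ℝ) * _)
          (fun j _ hj => by simp [hj]) (by simp)]
        simp
      rw [this]
      have h1 := (Finset.fold_max_le _).1 (ih (i :: L) (List.nodup_cons.2 ⟨hiL, hL⟩)
        (by simp only [List.length_cons]; omega))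
      have h2 := h1.2 i (Finset.mem_univ i)
      simp only [List.mem_cons, true_or, if_true] at h2
      rw [hval] at h0 hi
      rw [le_sub_iff_add_le, ← le_sub_iff_add_le]
      -- If the value of `i` is at most `U i`, nothing is charged. Otherwise the value net of the
      -- charge is `U i`, the highest index, which dominates every term.
      refine (Finset.fold_max_le _).2 ⟨?_, fun j _ => ?_⟩
      · rcases le_total (v i (p i) (m i) - U i (p i)) 0 with h | h
        · rw [max_eq_right h]; linarith [h1.1]
        · rw [max_eq_left h]; linarith
      · rcases le_total (v i (p i) (m i) - U i (p i)) 0 with h | h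
        · rw [max_eq_right h, sub_zero]
          refine le_trans ?_ (h1.2 j (Finset.mem_univ j))
          by_cases hj : j ∈ L
          · simp [hj]
          · by_cases hji : j = i
            · subst hji; simp [hj]
            · simp [hj, hji]
        · rw [max_eq_left h]
          linarith [hmin L j, hi j]

end IndexStrategy

/-! ### Bounded measurable functions and resampling a coordinate of a product law. -/

/-- Bounded measurable real functions, which are integrable for every finite measure. -/
def IsBoundedMeasurable {α : Type*} [MeasurableSpace α] (f : α → ℝ) : Prop :=
  Measurable f ∧ ∃ C, ∀ x, |f x| ≤ C

namespace IsBoundedMeasurable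

variable {α β : Type*} [MeasurableSpace α] [MeasurableSpace β] {f g : α → ℝ}

lemma const (r : ℝ) : IsBoundedMeasurable fun _ : α => r := ⟨measurable_const, |r|, fun _ => le_rfl⟩

lemma add (hf : IsBoundedMeasurable f) (hg : IsBoundedMeasurable g) :
    IsBoundedMeasurable fun x => f x + g x := by
  obtain ⟨hf, C, hC⟩ := hf
  obtain ⟨hg, D, hD⟩ := hg
  exact ⟨hf.add hg, C + D, fun x => (abs_add_le _ _).trans (add_le_add (hC x) (hD x))⟩

lemma sub (hf : IsBoundedMeasurable f) (hg : IsBoundedMeasurable g) :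
    IsBoundedMeasurable fun x => f x - g x := by
  obtain ⟨hf, C, hC⟩ := hf
  obtain ⟨hg, D, hD⟩ := hg
  exact ⟨hf.sub hg, C + D, fun x => (abs_sub _ _).trans (add_le_add (hC x) (hD x))⟩

lemma mul (hf : IsBoundedMeasurable f) (hg : IsBoundedMeasurable g) :
    IsBoundedMeasurable fun x => f x * g x := by
  obtain ⟨hf, C, hC⟩ := hf
  obtain ⟨hg, D, hD⟩ := hg
  refine ⟨hf.mul hg, C * D, fun x => ?_⟩
  rw [abs_mul]
  exact mul_le_mul (hC x) (hD x) (abs_nonneg _) ((abs_nonneg _).trans (hC x))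

lemma max (hf : IsBoundedMeasurable f) (hg : IsBoundedMeasurable g) :
    IsBoundedMeasurable fun x => max (f x) (g x) := by
  obtain ⟨hf, C, hC⟩ := hf
  obtain ⟨hg, D, hD⟩ := hg
  exact ⟨hf.max hg, Max.max C D, fun x =>
    (abs_max_le_max_abs_abs).trans (max_le_max (hC x) (hD x))⟩

lemma min (hf : IsBoundedMeasurable f) (hg : IsBoundedMeasurable g) :
    IsBoundedMeasurable fun x => min (f x) (g x) := by
  obtain ⟨hf, C, hC⟩ := hf
  obtain ⟨hg, D, hD⟩ := hg
  exact ⟨hf.min hg, Max.max C D, fun x =>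
    (abs_min_le_max_abs_abs).trans (max_le_max (hC x) (hD x))⟩

lemma sum {ι : Type*} (s : Finset ι) {f : ι → α → ℝ} (hf : ∀ i, IsBoundedMeasurable (f i)) :
    IsBoundedMeasurable fun x => ∑ i ∈ s, f i x := by
  classical
  induction s using Finset.induction_on with
  | empty => simpa using const 0
  | insert i s hi ih => simpa [Finset.sum_insert hi] using (hf i).add ih

lemma fold_max {ι : Type*} (s : Finset ι) {f : ι → α → ℝ} (hf : ∀ i, IsBoundedMeasurable (f i)) :
    IsBoundedMeasurable fun x => s.fold Max.max 0 fun i => f i x := by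
  classical
  induction s using Finset.induction_on with
  | empty => simpa using const 0
  | insert i s hi ih => simpa [Finset.fold_insert hi] using (hf i).max ih

lemma comp (hf : IsBoundedMeasurable f) {h : β → α} (hh : Measurable h) :
    IsBoundedMeasurable fun y => f (h y) := by
  obtain ⟨hf, C, hC⟩ := hf
  exact ⟨hf.comp hh, C, fun y => hC (h y)⟩

lemma coe_nnreal {f : α → ℝ≥0} (hf : Measurable f) (h1 : ∀ x, f x ≤ 1) :
    IsBoundedMeasurable fun x => (f x : ℝ) :=
  ⟨hf.coe_nnreal_real, 1, fun x => by rw [NNReal.abs_eq]; exact_mod_cast h1 x⟩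

lemma integrable (hf : IsBoundedMeasurable f) (m : Measure α) [IsFiniteMeasure m] :
    Integrable f m := by
  obtain ⟨hf, C, hC⟩ := hf
  exact Integrable.of_bound hf.aestronglyMeasurable C (.of_forall hC)

lemma integral {f : β → α → ℝ} (hf : IsBoundedMeasurable (Function.uncurry f)) (m : Measure α)
    [IsProbabilityMeasure m] : IsBoundedMeasurable fun y => ∫ x, f y x ∂m := by
  obtain ⟨hf, C, hC⟩ := hf
  refine ⟨(hf.stronglyMeasurable.integral_prod_right (ν := m)).measurable, C, fun y => ?_⟩
  have := norm_integral_le_of_norm_le_const (μ := m) (f := f y) (C := C)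
    (.of_forall fun x => hC (y, x))
  simpa using this

end IsBoundedMeasurable

/-- Drawing one coordinate of a product of probability measures afresh from another law. -/
lemma measurePreserving_update_pi {ι X : Type*} [Fintype ι] [DecidableEq ι] [MeasurableSpace X]
    (ν : ι → Measure X) [∀ i, IsProbabilityMeasure (ν i)] (j : ι) (τ : Measure X)
    [IsProbabilityMeasure τ] :
    MeasurePreserving (fun z : (ι → X) × X => Function.update z.1 j z.2)
      ((Measure.pi ν).prod τ) (Measure.pi (Function.update ν j τ)) := by
  have : ∀ i, IsProbabilityMeasure (Function.update ν j τ i) := by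
    intro i
    by_cases hi : i = j
    · subst hi; simpa
    · simpa [hi] using inferInstanceAs (IsProbabilityMeasure (ν i))
  refine ⟨measurable_update', (Measure.pi_eq fun s hs => ?_).symm⟩
  rw [Measure.map_apply measurable_update' (MeasurableSet.univ_pi hs)]
  have : (fun z : (ι → X) × X => Function.update z.1 j z.2) ⁻¹' Set.univ.pi s =
      (Set.univ.pi (Function.update s j Set.univ)) ×ˢ s j := by
    ext ⟨z, a⟩
    simp only [Set.mem_preimage, Set.mem_univ_pi, Set.mem_prod]
    constructor
    · intro h
      refine ⟨fun i => ?_, by simpa using h j⟩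
      by_cases hi : i = j
      · subst hi; simp
      · simpa [hi] using h i
    · rintro ⟨h, hj⟩ i
      by_cases hi : i = j
      · subst hi; simpa using hj
      · simpa [hi] using h i
  rw [this, Measure.prod_prod, Measure.pi_pi, ← Finset.prod_erase_mul _ _ (Finset.mem_univ j),
    ← Finset.prod_erase_mul (f := fun i => Function.update ν j τ i (s i)) _ (Finset.mem_univ j)]
  simp only [Function.update_self, measure_univ, mul_one]
  congr 1
  refine Finset.prod_congr rfl fun i hi => ?_
  rw [Function.update_of_ne (Finset.ne_of_mem_erase hi),
    Function.update_of_ne (Finset.ne_of_mem_erase hi)]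

/-- Resampling coordinate `j` preserves the product law and leaves `h` unchanged. This identifies
the message revealed by a visit to `j` with the `j`-th entry of a profile drawn in advance. -/
lemma integral_mul_integral_update_pi {ι X : Type*} [Fintype ι] [DecidableEq ι]
    [MeasurableSpace X] (ν : ι → Measure X) [∀ i, IsProbabilityMeasure (ν i)] (j : ι)
    {h F : (ι → X) → ℝ} (hh : IsBoundedMeasurable h) (hF : IsBoundedMeasurable F)
    (hj : ∀ m a, h (Function.update m j a) = h m) :
    ∫ m, h m * ∫ a, F (Function.update m j a) ∂ν j ∂Measure.pi ν =
      ∫ m, h m * F m ∂Measure.pi ν := by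
  have hmp := measurePreserving_update_pi ν j (ν j)
  rw [Function.update_eq_self] at hmp
  have hB := hh.mul hF
  calc ∫ m, h m * ∫ a, F (Function.update m j a) ∂ν j ∂Measure.pi ν
      = ∫ m, ∫ a, h (Function.update m j a) * F (Function.update m j a) ∂ν j ∂Measure.pi ν := by
        simp only [hj, integral_const_mul]
    _ = ∫ z, h (Function.update z.1 j z.2) * F (Function.update z.1 j z.2)
          ∂(Measure.pi ν).prod (ν j) :=
        (integral_prod (fun z : (ι → X) × X => h (Function.update z.1 j z.2) *
          F (Function.update z.1 j z.2)) ((hB.comp hmp.measurable).integrable _)).symm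
    _ = ∫ m, h m * F m ∂Measure.pi ν := by
        conv_rhs => rw [← hmp.map_eq]
        rw [integral_map hmp.measurable.aemeasurable]
        exact hB.1.aestronglyMeasurable

/-! ### Optimal search buys at the highest effective value. -/

namespace SearchStrategy

variable {n : ℕ} {M : Type*} [MeasurableSpace M]

lemma isBoundedMeasurable_buy (s : SearchStrategy n M) (p : Fin n → ℝ≥0) (L : List (Fin n))
    (i : Fin n) : IsBoundedMeasurable fun m => (s.buy p L m i : ℝ) :=
  .coe_nnreal ((s.measurable_buy L i).comp measurable_prodMk_left) fun _ => s.buy_le_one _ _ _ _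

lemma isBoundedMeasurable_visit (s : SearchStrategy n M) (p : Fin n → ℝ≥0) (L : List (Fin n))
    (i : Fin n) : IsBoundedMeasurable fun m => (s.visit p L m i : ℝ) :=
  .coe_nnreal ((s.measurable_visit L i).comp measurable_prodMk_left) fun _ => s.visit_le_one _ _ _ _

lemma isBoundedMeasurable_amortizedPayoff (s : SearchStrategy n M) {v : Fin n → M → ℝ}
    (hv : ∀ i, IsBoundedMeasurable (v i)) (U : Fin n → ℝ) (p : Fin n → ℝ≥0) (k : ℕ)
    (L : List (Fin n)) : IsBoundedMeasurable (s.amortizedPayoff v U p k L) := by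
  have hv' : ∀ i, IsBoundedMeasurable fun m : Fin n → M => v i (m i) := fun i =>
    (hv i).comp (measurable_pi_apply i)
  induction k generalizing L with
  | zero => exact .sum _ fun i => (s.isBoundedMeasurable_buy p L i).mul (hv' i)
  | succ k ih =>
    exact (IsBoundedMeasurable.sum _ fun i => (s.isBoundedMeasurable_buy p L i).mul (hv' i)).add
      (.sum _ fun j => (s.isBoundedMeasurable_visit p L j).mul
        ((ih _).sub (((hv' j).sub (.const _)).max (.const _))))

variable {μ c : ℝ} {conj : Fin n → Kernel (ℝ≥0 × Bool) M} {belief : Fin n → ℝ≥0 → M → ℝ}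
  {p : Fin n → ℝ≥0}

lemma isBoundedMeasurable_payoff (s : SearchStrategy n M)
    [∀ j, IsProbabilityMeasure (messageLaw μ (conj j) (p j))]
    (hb : ∀ i, IsBoundedMeasurable (belief i (p i))) (k : ℕ) (L : List (Fin n)) :
    IsBoundedMeasurable (s.payoff μ c conj belief p k L) := by
  have hv' : ∀ i, IsBoundedMeasurable fun m : Fin n → M => belief i (p i) (m i) - p i := fun i =>
    ((hb i).comp (measurable_pi_apply i)).sub (.const _)
  induction k generalizing L with
  | zero => exact .sum _ fun i => (s.isBoundedMeasurable_buy p L i).mul (hv' i)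
  | succ k ih =>
    refine (IsBoundedMeasurable.sum _ fun i => (s.isBoundedMeasurable_buy p L i).mul (hv' i)).add
      (.sum _ fun j => (s.isBoundedMeasurable_visit p L j).mul ((IsBoundedMeasurable.const _).add
        (IsBoundedMeasurable.integral (f := fun m a => s.payoff μ c conj belief p k (j :: L)
          (Function.update m j a)) ?_ _)))
    exact (ih (j :: L)).comp measurable_update'

/-- On average over the messages, search costs equal the amortized costs. -/
lemma integral_mul_payoff (s : SearchStrategy n M)
    [∀ j, IsProbabilityMeasure (messageLaw μ (conj j) (p j))]
    (hb : ∀ i, IsBoundedMeasurable (belief i (p i))) {U : Fin n → ℝ}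
    (hU : ∀ j, ∫ a, max (belief j (p j) a - p j - U j) 0 ∂messageLaw μ (conj j) (p j) = c)
    (k : ℕ) (L : List (Fin n)) {g : (Fin n → M) → ℝ} (hg : IsBoundedMeasurable g)
    (hgL : ∀ m m', (∀ i ∈ L, m i = m' i) → g m = g m') :
    ∫ m, g m * s.payoff μ c conj belief p k L m
        ∂Measure.pi (fun j => messageLaw μ (conj j) (p j)) =
      ∫ m, g m * s.amortizedPayoff (fun i a => belief i (p i) a - p i) U p k L m
        ∂Measure.pi (fun j => messageLaw μ (conj j) (p j)) := by
  set ν := fun j => messageLaw μ (conj j) (p j) with hν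
  have : ∀ j, IsProbabilityMeasure (ν j) := fun j => by rw [hν]; infer_instance
  have hv : ∀ i, IsBoundedMeasurable fun a => belief i (p i) a - p i := fun i =>
    (hb i).sub (.const _)
  have hv' : ∀ i, IsBoundedMeasurable fun m : Fin n → M => belief i (p i) (m i) - p i := fun i =>
    (hv i).comp (measurable_pi_apply i)
  have hP := fun k L => s.isBoundedMeasurable_payoff (μ := μ) (c := c) (conj := conj) hb k L
  have hR := fun k L => s.isBoundedMeasurable_amortizedPayoff hv U p k L
  -- The weight `g` must vary: a visit to `j` multiplies it by the visit probability, which is again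
  -- determined by the messages already seen.
  induction k generalizing L g with
  | zero => rfl
  | succ k ih =>
    have hpos : ∀ j, IsBoundedMeasurable fun m : Fin n → M =>
        max (belief j (p j) (m j) - p j - U j) 0 := fun j =>
      ((hv' j).sub (.const _)).max (.const _)
    have hbuy : IsBoundedMeasurable fun m =>
        g m * ∑ i, (s.buy p L m i : ℝ) * (belief i (p i) (m i) - p i) :=
      hg.mul (.sum _ fun i => (s.isBoundedMeasurable_buy p L i).mul (hv' i))
    have hgv : ∀ j, IsBoundedMeasurable fun m => g m * s.visit p L m j := fun j =>
      hg.mul (s.isBoundedMeasurable_visit p L j)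
    have hint : ∀ j, IsBoundedMeasurable fun m =>
        -c + ∫ a, s.payoff μ c conj belief p k (j :: L) (Function.update m j a) ∂ν j := fun j =>
      (IsBoundedMeasurable.const _).add (IsBoundedMeasurable.integral
        (f := fun m a => s.payoff μ c conj belief p k (j :: L) (Function.update m j a))
        ((hP k (j :: L)).comp measurable_update') _)
    have hl : ∀ m, g m * s.payoff μ c conj belief p (k + 1) L m =
        g m * ∑ i, (s.buy p L m i : ℝ) * (belief i (p i) (m i) - p i) +
        ∑ j, g m * s.visit p L m j *
          (-c + ∫ a, s.payoff μ c conj belief p k (j :: L) (Function.update m j a) ∂ν j) := by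
      intro m
      simp only [payoff, mul_add, Finset.mul_sum, mul_assoc, hν]
    have hr : ∀ m, g m * s.amortizedPayoff (fun i a => belief i (p i) a - p i) U p (k + 1) L m =
        g m * ∑ i, (s.buy p L m i : ℝ) * (belief i (p i) (m i) - p i) +
        ∑ j, g m * s.visit p L m j *
          (s.amortizedPayoff (fun i a => belief i (p i) a - p i) U p k (j :: L) m -
            max (belief j (p j) (m j) - p j - U j) 0) := by
      intro m
      simp only [amortizedPayoff, mul_add, Finset.mul_sum, mul_assoc]
    simp only [hl, hr]
    rw [integral_add (hbuy.integrable _)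
        ((IsBoundedMeasurable.sum _ fun j => (hgv j).mul (hint j)).integrable _),
      integral_add (hbuy.integrable _)
        ((IsBoundedMeasurable.sum _ fun j =>
          (hgv j).mul ((hR k (j :: L)).sub (hpos j))).integrable _),
      integral_finsetSum _ fun j _ => ((hgv j).mul (hint j)).integrable _,
      integral_finsetSum _ fun j _ => ((hgv j).mul ((hR k (j :: L)).sub (hpos j))).integrable _]
    congr 1
    refine Finset.sum_congr rfl fun j _ => ?_
    by_cases hj : j ∈ L
    · simp [s.visit_visited p L _ j hj]
    have hadapt : ∀ m m', (∀ i ∈ L, m i = m' i) →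
        g m * (s.visit p L m j : ℝ) = g m' * s.visit p L m' j := fun m m' h => by
      rw [hgL m m' h, s.visit_adapted p L m m' h]
    -- The cost is the mean excess of `j`, so it moves under the integral over the message about to
    -- be revealed.
    have hinner : ∀ m, -c + ∫ a, s.payoff μ c conj belief p k (j :: L) (Function.update m j a) ∂ν j
        = ∫ a, (fun m' => s.payoff μ c conj belief p k (j :: L) m' -
            max (belief j (p j) (m' j) - p j - U j) 0) (Function.update m j a) ∂ν j := by
      intro m
      simp only [Function.update_self]
      rw [integral_sub, hU j]
      · ring
      · exact ((hP k (j :: L)).comp (measurable_update m)).integrable _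
      · exact (((hv j).sub (.const _)).max (.const _)).integrable _
    simp only [hinner]
    rw [integral_mul_integral_update_pi ν j (hgv j) ((hP k (j :: L)).sub (hpos j))]
    · simp only [mul_sub (_ * _)]
      rw [integral_sub (((hgv j).mul (hP k _)).integrable _) (((hgv j).mul (hpos j)).integrable _),
        integral_sub (((hgv j).mul (hR k _)).integrable _) (((hgv j).mul (hpos j)).integrable _),
        ih (j :: L) (hgv j) fun m m' h => hadapt m m' fun i hi => h i (List.mem_cons_of_mem _ hi)]
    · intro m a
      refine hadapt _ _ fun i hi => Function.update_of_ne ?_ _ _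
      rintro rfl
      exact hj hi

/-- A search strategy that is optimal at the outset buys from a firm with the highest effective
value, provided that it is positive, for almost all messages. -/
lemma sum_buyProb_mul_eq_of_optimal (hn : 0 < n) (s : SearchStrategy n M)
    [∀ j, IsProbabilityMeasure (messageLaw μ (conj j) (p j))]
    (hb : ∀ i, Measurable fun z : ℝ≥0 × M => belief i z.1 z.2)
    (hb01 : ∀ i q a, belief i q a ∈ Set.Icc (0 : ℝ) 1) {U : Fin n → ℝ}
    (hU : ∀ j, ∫ a, max (belief j (p j) a - p j - U j) 0 ∂messageLaw μ (conj j) (p j) = c)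
    (hopt : ∀ (t : SearchStrategy n M) m,
      t.payoff μ c conj belief p n [] m ≤ s.payoff μ c conj belief p n [] m) :
    ∀ᵐ m ∂Measure.pi (fun j => messageLaw μ (conj j) (p j)),
      ∑ i, (s.buyProb i p m n [] : ℝ) * min (belief i (p i) (m i) - p i) (U i) =
        Finset.univ.fold max 0 fun i => min (belief i (p i) (m i) - p i) (U i) := by
  have hbB : ∀ i, IsBoundedMeasurable (belief i (p i)) := fun i =>
    ⟨(hb i).comp measurable_prodMk_left, 1, fun a => by
      rw [abs_of_nonneg (hb01 i _ a).1]; exact (hb01 i _ a).2⟩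
  have hv : ∀ i, IsBoundedMeasurable fun a => belief i (p i) a - p i := fun i =>
    (hbB i).sub (.const _)
  have hw : ∀ i, IsBoundedMeasurable fun m : Fin n → M =>
      min (belief i (p i) (m i) - p i) (U i) := fun i =>
    ((hv i).comp (measurable_pi_apply i)).min (.const _)
  let t : SearchStrategy n M := indexStrategy (fun i q a => belief i q a - q) (fun i _ => U i)
    (fun i => (hb i).sub (by fun_prop)) (fun i => measurable_const)
  have hle : ∀ m, ∑ i, (s.buyProb i p m n [] : ℝ) * min (belief i (p i) (m i) - p i) (U i) ≤
      Finset.univ.fold max 0 fun i => min (belief i (p i) (m i) - p i) (U i) := by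
    intro m
    set W := Finset.univ.fold max 0 fun i => min (belief i (p i) (m i) - p i) (U i)
    have hW := (Finset.fold_max_le _).1 (le_refl W)
    have h1 : ∑ i, (s.buyProb i p m n [] : ℝ) ≤ 1 := by
      exact_mod_cast s.sum_buyProb_le_one p m n []
    calc ∑ i, (s.buyProb i p m n [] : ℝ) * min (belief i (p i) (m i) - p i) (U i)
        ≤ ∑ i, (s.buyProb i p m n [] : ℝ) * W :=
          Finset.sum_le_sum fun i hi => mul_le_mul_of_nonneg_left (hW.2 i hi) (NNReal.coe_nonneg _)
      _ = (∑ i, (s.buyProb i p m n [] : ℝ)) * W := (Finset.sum_mul _ _ _).symm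
      _ ≤ 1 * W := mul_le_mul_of_nonneg_right h1 hW.1
      _ = W := one_mul W
  have hA : IsBoundedMeasurable fun m =>
      ∑ i, (s.buyProb i p m n [] : ℝ) * min (belief i (p i) (m i) - p i) (U i) :=
    .sum _ fun i => (IsBoundedMeasurable.coe_nnreal
      ((s.measurable_buyProb i n []).comp measurable_prodMk_left)
      fun _ => s.buyProb_le_one _ _ _ _ _).mul (hw i)
  have hΦ : IsBoundedMeasurable fun m : Fin n → M =>
      Finset.univ.fold max 0 fun i => min (belief i (p i) (m i) - p i) (U i) := .fold_max _ hw
  have hR := fun s : SearchStrategy n M => s.isBoundedMeasurable_amortizedPayoff hv U p n []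
  have hP := fun s : SearchStrategy n M =>
    s.isBoundedMeasurable_payoff (μ := μ) (c := c) (conj := conj) hbB n []
  have hPR := fun s : SearchStrategy n M =>
    s.integral_mul_payoff (μ := μ) (c := c) (conj := conj) hbB hU n [] (g := fun _ => 1)
      (.const 1) fun _ _ _ => rfl
  simp only [one_mul] at hPR
  -- A pointwise inequality with equal integrals is an almost sure equality. The index strategy
  -- attains the maximum on average, and `s` does at least as well.
  refine (integral_eq_iff_of_ae_le (hA.integrable _) (hΦ.integrable _) (.of_forall hle)).1 ?_
  refine le_antisymm (integral_mono (hA.integrable _) (hΦ.integrable _) hle) ?_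
  calc _ ≤ _ := integral_mono (hΦ.integrable _) ((hR t).integrable _) fun m => by
        simpa using fold_le_amortizedPayoff_indexStrategy
          (v := fun i q a => belief i q a - q) (U := fun i _ => U i)
          (hv := fun i => (hb i).sub (by fun_prop)) (hU := fun i => measurable_const)
          hn p m n [] List.nodup_nil (by simp)
    _ = _ := (hPR t).symm
    _ ≤ _ := integral_mono ((hP t).integrable _) ((hP s).integrable _) (hopt t)
    _ = _ := hPR s
    _ ≤ _ := integral_mono ((hR s).integrable _) (hA.integrable _) fun m => by
        simpa using s.amortizedPayoff_le (fun i a => belief i (p i) a - p i) U p m n []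

end SearchStrategy

/-! ### From fixed to random price profiles. -/

section PiCompProd

variable {ι X Y : Type*} [Fintype ι] [MeasurableSpace X] [MeasurableSpace Y]

/-- A product of composition-products disintegrates over the product of the first marginals. -/
lemma pi_compProd_eq_bind (ρ : ι → Measure X) [∀ i, IsProbabilityMeasure (ρ i)]
    (κ : ι → Kernel X Y) [∀ i, IsMarkovKernel (κ i)] :
    Measurable (fun p : ι → X =>
      (Measure.pi fun i => κ i (p i)).map fun (m : ι → Y) i => (p i, m i)) ∧
    Measure.pi (fun i => ρ i ⊗ₘ κ i) = (Measure.pi ρ).bind fun p =>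
      (Measure.pi fun i => κ i (p i)).map fun (m : ι → Y) i => (p i, m i) := by
  have hzip : ∀ p : ι → X, Measurable fun (m : ι → Y) i => (p i, m i) := fun p =>
    measurable_pi_lambda _ fun i => measurable_const.prodMk (measurable_pi_apply i)
  have hbox : ∀ (p : ι → X) (s : ι → Set (X × Y)), (∀ i, MeasurableSet (s i)) →
      ((Measure.pi fun i => κ i (p i)).map fun (m : ι → Y) i => (p i, m i)) (Set.univ.pi s) =
        ∏ i, κ i (p i) (Prod.mk (p i) ⁻¹' s i) := by
    intro p s hs
    rw [Measure.map_apply (hzip p) (MeasurableSet.univ_pi hs), ← Measure.pi_pi]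
    rfl
  have hκ : ∀ i (s : Set (X × Y)), MeasurableSet s →
      Measurable fun x => κ i x (Prod.mk x ⁻¹' s) := fun i s hs =>
    Kernel.measurable_kernel_prodMk_left hs
  have hmeas : Measurable (fun p : ι → X =>
      (Measure.pi fun i => κ i (p i)).map fun (m : ι → Y) i => (p i, m i)) := by
    have : ∀ p : ι → X, IsProbabilityMeasure
        ((Measure.pi fun i => κ i (p i)).map fun (m : ι → Y) i => (p i, m i)) := fun p =>
      Measure.isProbabilityMeasure_map (hzip p).aemeasurable
    refine Measurable.measure_of_isPiSystem_of_isProbabilityMeasure generateFrom_pi.symm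
      isPiSystem_pi ?_
    rintro _ ⟨s, hs, rfl⟩
    simp only [Set.mem_pi, Set.mem_univ, true_implies] at hs
    simp only [hbox _ s hs]
    exact Finset.measurable_prod _ fun i _ => (hκ i _ (hs i)).comp (measurable_pi_apply i)
  refine ⟨hmeas, Measure.pi_eq fun s hs => ?_⟩
  rw [Measure.bind_apply (MeasurableSet.univ_pi hs) hmeas.aemeasurable]
  simp only [hbox _ s hs]
  rw [lintegral_prod_eq_prod_lintegral_of_indepFun Finset.univ
    (fun i (p : ι → X) => κ i (p i) (Prod.mk (p i) ⁻¹' s i))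
    (iIndepFun_pi (X := fun i x => κ i x (Prod.mk x ⁻¹' s i))
      fun i => (hκ i _ (hs i)).aemeasurable)
    fun i => (hκ i _ (hs i)).comp (measurable_pi_apply i)]
  refine Finset.prod_congr rfl fun i _ => ?_
  rw [Measure.compProd_apply (hs i),
    (measurePreserving_eval ρ i).lintegral_comp (hκ i _ (hs i))]

/-- Optimality of search is known for each price profile separately; this allows prices to be drawn
as well. -/
lemma ae_pi_compProd_of_forall (ρ : ι → Measure X) [∀ i, IsProbabilityMeasure (ρ i)]
    (κ : ι → Kernel X Y) [∀ i, IsMarkovKernel (κ i)] {P : (ι → X × Y) → Prop}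
    (hP : MeasurableSet {ω | P ω})
    (h : ∀ p : ι → X, ∀ᵐ m ∂Measure.pi (fun i => κ i (p i)), P fun i => (p i, m i)) :
    ∀ᵐ ω ∂Measure.pi (fun i => ρ i ⊗ₘ κ i), P ω := by
  obtain ⟨hmeas, heq⟩ := pi_compProd_eq_bind ρ κ
  have hzip : ∀ p : ι → X, Measurable fun (m : ι → Y) i => (p i, m i) := fun p =>
    measurable_pi_lambda _ fun i => measurable_const.prodMk (measurable_pi_apply i)
  rw [ae_iff, heq]
  change Measure.bind _ _ {ω | P ω}ᶜ = 0
  rw [Measure.bind_apply hP.compl hmeas.aemeasurable]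
  refine (lintegral_congr fun p => ?_).trans lintegral_zero
  rw [Measure.map_apply (hzip p) hP.compl]
  exact ae_iff.1 (h p)

end PiCompProd

/-! ### Reservation values and effective values. -/

section Reservation

variable {M : Type*} [MeasurableSpace M]

/-- Expected excess, over `U`, of the net value of a firm with price `q`. -/
def expectedExcess (κ : Kernel ℝ≥0 M) (b : ℝ≥0 → M → ℝ) (q : ℝ≥0) (U : ℝ) : ℝ :=
  ∫ a, max (b q a - q - U) 0 ∂κ q

/-- The least reservation value of a firm with price `q`. -/
def reservationValue (c : ℝ) (κ : Kernel ℝ≥0 M) (b : ℝ≥0 → M → ℝ) (q : ℝ≥0) : ℝ :=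
  sInf {U | expectedExcess κ b q U ≤ c}

/-- The effective value of a firm with price `q` and message `a`. -/
def effectiveValue (c : ℝ) (κ : Kernel ℝ≥0 M) (b : ℝ≥0 → M → ℝ) (q : ℝ≥0) (a : M) : ℝ :=
  min (b q a - q) (reservationValue c κ b q)

variable {κ : Kernel ℝ≥0 M} [IsMarkovKernel κ] {b : ℝ≥0 → M → ℝ} {μ c : ℝ}
  (hb : Measurable fun z : ℝ≥0 × M => b z.1 z.2) (hb01 : ∀ q a, b q a ∈ Set.Icc (0 : ℝ) 1)
include hb hb01

lemma isBoundedMeasurable_belief (q : ℝ≥0) : IsBoundedMeasurable (b q) :=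
  ⟨hb.comp measurable_prodMk_left, 1, fun a => by
    rw [abs_of_nonneg (hb01 q a).1]; exact (hb01 q a).2⟩

lemma isBoundedMeasurable_excess (q : ℝ≥0) (U : ℝ) :
    IsBoundedMeasurable fun a => max (b q a - q - U) 0 :=
  (((isBoundedMeasurable_belief hb hb01 q).sub (.const _)).sub (.const _)).max (.const _)

lemma expectedExcess_antitone (q : ℝ≥0) : Antitone (expectedExcess κ b q) := by
  intro U U' h
  refine integral_mono ((isBoundedMeasurable_excess hb hb01 q U').integrable _)
    ((isBoundedMeasurable_excess hb hb01 q U).integrable _) fun a => ?_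
  exact max_le_max (by linarith) le_rfl

lemma continuous_expectedExcess (q : ℝ≥0) : Continuous (expectedExcess κ b q) := by
  refine (LipschitzWith.of_le_add fun U U' => ?_).continuous
  have h1 := (isBoundedMeasurable_excess hb hb01 q U').integrable (κ q)
  calc expectedExcess κ b q U ≤ ∫ a, (max (b q a - q - U') 0 + dist U U') ∂κ q := by
        refine integral_mono ((isBoundedMeasurable_excess hb hb01 q U).integrable _)
          (h1.add (integrable_const _)) fun a => ?_
        have : U' - U ≤ dist U U' := by
          rw [Real.dist_eq, abs_sub_comm]; exact le_abs_self _
        refine max_le ?_ (add_nonneg (le_max_right _ _) dist_nonneg)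
        linarith [le_max_left (b q a - q - U') 0]
    _ = expectedExcess κ b q U' + dist U U' := by
        rw [integral_add h1 (integrable_const _)]; simp [expectedExcess]

/-- The positive part dominates its argument. This bounds from below the set whose infimum is
`reservationValue`. -/
lemma sub_le_expectedExcess {q : ℝ≥0} (hμ : ∫ a, b q a ∂κ q = μ) (U : ℝ) :
    μ - q - U ≤ expectedExcess κ b q U := by
  have h1 := (isBoundedMeasurable_belief hb hb01 q).integrable (κ q)
  have h2 : Integrable (fun a => b q a - q) (κ q) := h1.sub (integrable_const _)
  calc μ - q - U = ∫ a, (b q a - q - U) ∂κ q := by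
        rw [integral_sub h2 (integrable_const _),
          integral_sub h1 (integrable_const _), hμ]
        simp
    _ ≤ _ := integral_mono (h2.sub (integrable_const _))
        ((isBoundedMeasurable_excess hb hb01 q U).integrable _) fun a => le_max_left _ _

omit [IsMarkovKernel κ] hb in
lemma expectedExcess_one (q : ℝ≥0) : expectedExcess κ b q 1 = 0 := by
  refine (integral_congr_ae (.of_forall fun a => ?_)).trans (integral_zero _ _)
  exact max_eq_right (by linarith [(hb01 q a).2, q.coe_nonneg])

/-- The excess is continuous and antitone in `U`, so its sublevel set is a closed half-line starting
at its infimum. This covers `c = 0`, where reservation values are not unique, and gives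
measurability in the price. -/
lemma reservationValue_le_iff (hc : 0 ≤ c) {q : ℝ≥0} (hμ : ∫ a, b q a ∂κ q = μ) (U : ℝ) :
    reservationValue c κ b q ≤ U ↔ expectedExcess κ b q U ≤ c := by
  have hbdd : BddBelow {U | expectedExcess κ b q U ≤ c} :=
    ⟨μ - q - c, fun U (hU : _ ≤ c) => by
      linarith [sub_le_expectedExcess (κ := κ) hb hb01 hμ U]⟩
  have hne : {U | expectedExcess κ b q U ≤ c}.Nonempty :=
    ⟨1, by rw [Set.mem_ofPred_eq, expectedExcess_one hb01]; exact hc⟩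
  have hcl : IsClosed {U | expectedExcess κ b q U ≤ c} :=
    isClosed_le (continuous_expectedExcess hb hb01 q) continuous_const
  have hmem : expectedExcess κ b q (reservationValue c κ b q) ≤ c := hcl.csInf_mem hne hbdd
  exact ⟨fun h => (expectedExcess_antitone hb hb01 q h).trans hmem, fun h => csInf_le hbdd h⟩

lemma expectedExcess_reservationValue (hc : 0 ≤ c) {q : ℝ≥0} (hμ : ∫ a, b q a ∂κ q = μ) :
    expectedExcess κ b q (reservationValue c κ b q) = c := by
  have h := reservationValue_le_iff (c := c) (κ := κ) hb hb01 hc hμ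
  refine le_antisymm ((h _).1 le_rfl) ?_
  obtain ⟨U, hU⟩ := mem_range_of_exists_le_of_exists_ge (c := c)
    (continuous_expectedExcess (κ := κ) hb hb01 q)
    ⟨1, (expectedExcess_one hb01 q).le.trans hc⟩
    ⟨μ - q - c, by linarith [sub_le_expectedExcess (κ := κ) hb hb01 hμ (μ - q - c)]⟩
  exact hU.symm.le.trans (expectedExcess_antitone hb hb01 q ((h U).2 hU.le))

lemma measurable_reservationValue (hc : 0 ≤ c) (hμ : ∀ q, ∫ a, b q a ∂κ q = μ) :
    Measurable (reservationValue c κ b) := by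
  refine measurable_of_Iic fun t => ?_
  have : reservationValue c κ b ⁻¹' Set.Iic t = {q | expectedExcess κ b q t ≤ c} := by
    ext q
    exact reservationValue_le_iff hb hb01 hc (hμ q) t
  rw [this]
  refine measurableSet_le ?_ measurable_const
  have hm : Measurable (Function.uncurry fun (q : ℝ≥0) (a : M) => max (b q a - q - t) 0) :=
    ((hb.sub (by fun_prop)).sub measurable_const).max measurable_const
  exact (hm.stronglyMeasurable.integral_kernel_prod_right (κ := κ)).measurable

lemma measurable_effectiveValue (hc : 0 ≤ c) (hμ : ∀ q, ∫ a, b q a ∂κ q = μ) :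
    Measurable fun z : ℝ≥0 × M => effectiveValue c κ b z.1 z.2 :=
  (hb.sub (by fun_prop)).min
    ((measurable_reservationValue (κ := κ) hb hb01 hc hμ).comp measurable_fst)

omit [IsMarkovKernel κ] in
lemma isBoundedMeasurable_effectiveValue (q : ℝ≥0) :
    IsBoundedMeasurable (effectiveValue c κ b q) :=
  ((isBoundedMeasurable_belief hb hb01 q).sub (.const _)).min (.const _)

/-- The effective value is the net value minus its excess over the reservation value, and the excess
has mean `c`. Hence information redistributes effective value but cannot change its mean. -/
lemma integral_effectiveValue (hc : 0 ≤ c) {q : ℝ≥0} (hμ : ∫ a, b q a ∂κ q = μ) :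
    ∫ a, effectiveValue c κ b q a ∂κ q = μ - c - q := by
  have h1 := (isBoundedMeasurable_belief hb hb01 q).integrable (κ q)
  have h2 := isBoundedMeasurable_excess hb hb01 q (reservationValue c κ b q)
  have h3 : Integrable (fun a => b q a - q) (κ q) := h1.sub (integrable_const _)
  have : ∀ a, effectiveValue c κ b q a =
      b q a - q - max (b q a - q - reservationValue c κ b q) 0 := by
    intro a
    rw [effectiveValue]
    rcases le_total (b q a - q) (reservationValue c κ b q) with h | h
    · rw [min_eq_left h, max_eq_right (by linarith)]; ring
    · rw [min_eq_right h, max_eq_left (by linarith)]; ring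
  simp only [this]
  rw [integral_sub h3 (h2.integrable _),
    integral_sub h1 (integrable_const _), hμ]
  have := expectedExcess_reservationValue (κ := κ) hb hb01 hc hμ
  rw [expectedExcess] at this
  rw [this]
  simp
  ring

end Reservation

/-! ### Message laws as kernels, and distributions that attain a maximum on average. -/

section MessageKernel

variable {M : Type*} [MeasurableSpace M] {μ : ℝ}

/-- `messageLaw` as a kernel from prices to messages. -/
def messageKernel (μ : ℝ) (σ : Kernel (ℝ≥0 × Bool) M) : Kernel ℝ≥0 M where
  toFun := messageLaw μ σ
  measurable' := by
    refine Measure.measurable_of_measurable_coe _ fun s hs => ?_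
    have h : ∀ x : Bool, Measurable fun q : ℝ≥0 => σ (q, x) s := fun x =>
      (σ.measurable_coe hs).comp (measurable_id.prodMk measurable_const)
    simp only [messageLaw, Measure.add_apply, Measure.smul_apply, smul_eq_mul]
    exact ((h true).const_mul _).add ((h false).const_mul _)

lemma messageKernel_apply (σ : Kernel (ℝ≥0 × Bool) M) (q : ℝ≥0) :
    messageKernel μ σ q = messageLaw μ σ q := rfl

lemma ofReal_add_ofReal_one_sub (hμ0 : 0 ≤ μ) (hμ1 : μ ≤ 1) :
    ENNReal.ofReal μ + ENNReal.ofReal (1 - μ) = 1 := by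
  rw [← ENNReal.ofReal_add hμ0 (by linarith)]
  simp

lemma isMarkovKernel_messageKernel (hμ0 : 0 ≤ μ) (hμ1 : μ ≤ 1) (σ : Kernel (ℝ≥0 × Bool) M)
    [IsMarkovKernel σ] : IsMarkovKernel (messageKernel μ σ) :=
  ⟨fun q => ⟨by simp [messageKernel_apply, messageLaw, ofReal_add_ofReal_one_sub hμ0 hμ1]⟩⟩

lemma lintegral_messageKernel (σ : Kernel (ℝ≥0 × Bool) M) (q : ℝ≥0) (f : M → ℝ≥0∞) :
    ∫⁻ a, f a ∂messageKernel μ σ q =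
      ENNReal.ofReal μ * ∫⁻ a, f a ∂σ (q, true) +
        ENNReal.ofReal (1 - μ) * ∫⁻ a, f a ∂σ (q, false) := by
  simp [messageKernel_apply, messageLaw]

instance : SFinite (typeLaw μ) := by
  unfold typeLaw; infer_instance

end MessageKernel

/-- The firms in the support of a buying distribution that attains the highest nonnegative
value `max 0 w` on average attain it each; the distribution is total if that value is positive. -/
lemma buy_max_of_sum_mul_eq_fold {ι : Type*} [Fintype ι] {A w : ι → ℝ}
    (hA : ∀ i, 0 ≤ A i) (hA1 : ∑ i, A i ≤ 1)
    (h : ∑ i, A i * w i = Finset.univ.fold max 0 w) :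
    (∀ i, A i ≠ 0 → 0 ≤ w i ∧ ∀ j, w j ≤ w i) ∧
      ∀ i, 0 < w i → (∀ j, j ≠ i → w j < w i) → A i = 1 := by
  classical
  set W := Finset.univ.fold max 0 w with hWdef
  have hW := (Finset.fold_max_le _).1 (le_refl W)
  -- The shortfall from `W` has two nonnegative parts, from buying at inferior firms and from not
  -- buying; both must vanish.
  have h1 : ∑ i, A i * (W - w i) + (1 - ∑ i, A i) * W = 0 := by
    simp only [mul_sub, Finset.sum_sub_distrib, ← Finset.sum_mul, h]
    ring
  have hnn : ∀ i ∈ Finset.univ, 0 ≤ A i * (W - w i) := fun i hi =>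
    mul_nonneg (hA i) (sub_nonneg.2 (hW.2 i hi))
  have h2 : 0 ≤ (1 - ∑ i, A i) * W := mul_nonneg (by linarith) hW.1
  have h3 := Finset.sum_nonneg hnn
  have h4 : ∑ i, A i * (W - w i) = 0 := by linarith
  have h5 : (1 - ∑ i, A i) * W = 0 := by linarith
  have h6 := (Finset.sum_eq_zero_iff_of_nonneg hnn).1 h4
  have key : ∀ i, A i ≠ 0 → w i = W := fun i hi => by
    rcases mul_eq_zero.1 (h6 i (Finset.mem_univ i)) with h | h
    · exact absurd h hi
    · linarith
  refine ⟨fun i hi => ?_, fun i hi hj => ?_⟩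
  · rw [key i hi]
    exact ⟨hW.1, fun j => hW.2 j (Finset.mem_univ j)⟩
  · have hWpos : 0 < W := hi.trans_le (hW.2 i (Finset.mem_univ i))
    have hsum : ∑ i, A i = 1 := by
      rcases mul_eq_zero.1 h5 with h | h <;> linarith
    rw [← hsum, Finset.sum_eq_single i]
    · intro j _ hji
      by_contra hne
      have := hW.2 i (Finset.mem_univ i)
      rw [← key j hne] at this
      exact absurd (hj j hji) (not_lt.2 this)
    · simp

/-! ### The consumer's purchases in equilibrium. -/

namespace SymmetricAssessment

variable {n : ℕ} {M : Type*} [MeasurableSpace M]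

/-- The effective value to the consumer of firm `i` with a given price and message. -/
def firmValue (A : SymmetricAssessment n M) (μ c : ℝ) (i : Fin n) : ℝ≥0 → M → ℝ :=
  effectiveValue c (messageKernel μ (A.conj i)) (A.belief i)

/-- The probability that firm `i` sells in a realized profile of prices and messages. -/
def realizedSale (A : SymmetricAssessment n M) (i : Fin n) (ω : Fin n → ℝ≥0 × M) : ℝ≥0 :=
  A.search.buyProb i (fun j => (ω j).1) (fun j => (ω j).2) n []

/-- The consumer buys only at the highest nonnegative effective value, and surely so when it is
positive and attained by a single firm. -/
def BuysBest (A : SymmetricAssessment n M) (μ c : ℝ) (ω : Fin n → ℝ≥0 × M) : Prop :=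
  (∀ i, A.realizedSale i ω ≠ 0 → 0 ≤ A.firmValue μ c i (ω i).1 (ω i).2 ∧
    ∀ j, A.firmValue μ c j (ω j).1 (ω j).2 ≤ A.firmValue μ c i (ω i).1 (ω i).2) ∧
  ∀ i, 0 < A.firmValue μ c i (ω i).1 (ω i).2 →
    (∀ j, j ≠ i → A.firmValue μ c j (ω j).1 (ω j).2 < A.firmValue μ c i (ω i).1 (ω i).2) →
    A.realizedSale i ω = 1

variable (A : SymmetricAssessment n M) {μ c : ℝ}

lemma measurable_realizedSale (i : Fin n) : Measurable (A.realizedSale i) :=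
  (A.search.measurable_buyProb i n []).comp
    (f := fun ω : Fin n → ℝ≥0 × M => (fun j => (ω j).1, fun j => (ω j).2)) (by fun_prop)

lemma realizedSale_le_one (i : Fin n) (ω : Fin n → ℝ≥0 × M) : A.realizedSale i ω ≤ 1 :=
  A.search.buyProb_le_one _ _ _ _ _

lemma sum_realizedSale_le_one (ω : Fin n → ℝ≥0 × M) : ∑ i, A.realizedSale i ω ≤ 1 :=
  A.search.sum_buyProb_le_one _ _ _ _

lemma saleProb_eq_lintegral (i : Fin n) (q : ℝ≥0) (a : M) :
    A.saleProb μ i q a =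
      ∫⁻ ω, A.realizedSale i (Function.update ω i (q, a))
        ∂Measure.pi (fun _ : Fin n => A.playLaw μ) := by
  have h1 : ∀ ω : Fin n → ℝ≥0 × M,
      (fun j => (Function.update ω i (q, a) j).1) = Function.update (fun j => (ω j).1) i q := by
    intro ω
    funext j
    by_cases hj : j = i
    · subst hj; simp
    · simp [hj]
  have h2 : ∀ ω : Fin n → ℝ≥0 × M,
      (fun j => (Function.update ω i (q, a) j).2) = Function.update (fun j => (ω j).2) i a := by
    intro ω
    funext j
    by_cases hj : j = i
    · subst hj; simp
    · simp [hj]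
  simp only [realizedSale, h1, h2]
  rfl

lemma playLaw_eq_compProd :
    A.playLaw μ = A.priceLaw ⊗ₘ messageKernel μ A.message := by
  have := A.isProb_priceLaw
  have := A.isMarkov_message
  have hs : IsSFiniteKernel (messageKernel μ A.message) := by
    have : IsFiniteKernel (messageKernel μ A.message) :=
      ⟨⟨ENNReal.ofReal μ + ENNReal.ofReal (1 - μ), by finiteness, fun q => by
        simp [messageKernel_apply, messageLaw]⟩⟩
    infer_instance
  ext s hs
  have hm : Measurable fun z : (ℝ≥0 × Bool) × M => (z.1.1, z.2) := by fun_prop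
  have hk : Measurable fun z : ℝ≥0 × Bool => A.message z {a | (z.1, a) ∈ s} :=
    Kernel.measurable_kernel_prodMk_left (κ := A.message) (hm hs)
  rw [playLaw, Measure.map_apply hm hs, Measure.compProd_apply (hm hs), Measure.compProd_apply hs]
  change ∫⁻ z, A.message z {a | (z.1, a) ∈ s} ∂_ = _
  rw [lintegral_prod _ hk.aemeasurable]
  refine lintegral_congr fun q => ?_
  simp only [typeLaw, lintegral_add_measure, lintegral_smul_measure, lintegral_dirac,
    messageKernel_apply, messageLaw, Measure.add_apply, Measure.smul_apply]
  rfl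

instance [Fact (0 ≤ μ ∧ μ ≤ 1)] (σ : Kernel (ℝ≥0 × Bool) M) [IsMarkovKernel σ] :
    IsMarkovKernel (messageKernel μ σ) :=
  isMarkovKernel_messageKernel (Fact.out : 0 ≤ μ ∧ μ ≤ 1).1 (Fact.out : 0 ≤ μ ∧ μ ≤ 1).2 σ

instance : IsProbabilityMeasure A.priceLaw := A.isProb_priceLaw
instance : IsMarkovKernel A.message := A.isMarkov_message
instance (i : Fin n) : IsMarkovKernel (A.conj i) := A.isMarkov_conj i

instance [Fact (0 ≤ μ ∧ μ ≤ 1)] : IsProbabilityMeasure (A.playLaw μ) := by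
  rw [playLaw_eq_compProd]; infer_instance

variable {A} [hμ : Fact (0 ≤ μ ∧ μ ≤ 1)]

namespace IsEquilibrium

variable (hA : A.IsEquilibrium μ c)
include hA

lemma playLaw_eq_conj (i : Fin n) :
    A.playLaw μ = A.priceLaw ⊗ₘ messageKernel μ (A.conj i) := by
  rw [playLaw_eq_compProd]
  refine Measure.compProd_congr ?_
  filter_upwards [hA.conj_correct i] with q hq
  simp [messageKernel_apply, messageLaw, hq]

omit hμ in
lemma integral_belief (i : Fin n) (q : ℝ≥0) :
    ∫ a, A.belief i q a ∂messageKernel μ (A.conj i) q = μ := by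
  have := hA.bayes i q Set.univ MeasurableSet.univ
  simpa [messageKernel_apply] using this

lemma measurable_firmValue (hc : 0 ≤ c) (i : Fin n) :
    Measurable fun z : ℝ≥0 × M => A.firmValue μ c i z.1 z.2 :=
  measurable_effectiveValue (A.measurable_belief i) (A.belief_mem i) hc (hA.integral_belief i)

lemma integral_firmValue (hc : 0 ≤ c) (i : Fin n) (q : ℝ≥0) :
    ∫ a, A.firmValue μ c i q a ∂messageKernel μ (A.conj i) q = μ - c - q :=
  integral_effectiveValue (A.measurable_belief i) (A.belief_mem i) hc (hA.integral_belief i q)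

/-- Search is optimal at every price, so the price laws `ρ` are arbitrary; messages follow the
consumer's conjectures. -/
lemma ae_buysBest (hc : 0 ≤ c) (hn : 0 < n) (ρ : Fin n → Measure ℝ≥0)
    [∀ i, IsProbabilityMeasure (ρ i)] :
    ∀ᵐ ω ∂Measure.pi (fun i => ρ i ⊗ₘ messageKernel μ (A.conj i)), A.BuysBest μ c ω := by
  have hw : ∀ i, Measurable fun ω : Fin n → ℝ≥0 × M => A.firmValue μ c i (ω i).1 (ω i).2 :=
    fun i => (hA.measurable_firmValue hc i).comp (measurable_pi_apply i)
  have hfold : ∀ s : Finset (Fin n), Measurable fun ω : Fin n → ℝ≥0 × M =>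
      s.fold max 0 fun i => A.firmValue μ c i (ω i).1 (ω i).2 := by
    intro s
    induction s using Finset.induction_on with
    | empty => simp
    | insert i s hi ih => simpa only [Finset.fold_insert hi] using (hw i).max ih
  have key := ae_pi_compProd_of_forall ρ (fun i => messageKernel μ (A.conj i))
    (P := fun ω => ∑ i, (A.realizedSale i ω : ℝ) * A.firmValue μ c i (ω i).1 (ω i).2 =
      Finset.univ.fold max 0 fun i => A.firmValue μ c i (ω i).1 (ω i).2)
    (measurableSet_eq_fun (Finset.measurable_sum _ fun i _ =>
      (A.measurable_realizedSale i).coe_nnreal_real.mul (hw i)) (hfold _)) ?_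
  · filter_upwards [key] with ω hω
    have := buy_max_of_sum_mul_eq_fold (fun i => NNReal.coe_nonneg (A.realizedSale i ω))
      (by exact_mod_cast A.sum_realizedSale_le_one ω) hω
    unfold BuysBest
    exact_mod_cast this
  · intro p
    have : ∀ j, IsProbabilityMeasure (messageLaw μ (A.conj j) (p j)) := fun j =>
      inferInstanceAs (IsProbabilityMeasure (messageKernel μ (A.conj j) (p j)))
    exact A.search.sum_buyProb_mul_eq_of_optimal (μ := μ) (c := c) (conj := A.conj) hn
      A.measurable_belief A.belief_mem
      (U := fun i => reservationValue c (messageKernel μ (A.conj i)) (A.belief i) (p i))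
      (fun j => expectedExcess_reservationValue (A.measurable_belief j) (A.belief_mem j) hc
        (hA.integral_belief j (p j)))
      fun t m => by simpa using hA.consumer_optimal t p [] m List.nodup_nil

lemma ae_buysBest_playLaw (hc : 0 ≤ c) (hn : 0 < n) :
    ∀ᵐ ω ∂Measure.pi (fun _ : Fin n => A.playLaw μ), A.BuysBest μ c ω := by
  have := hA.ae_buysBest hc hn fun _ => A.priceLaw
  simpa only [← hA.playLaw_eq_conj] using this

/-- A point mass as the price law of firm `i` captures a deviation to `q`, possibly off the path.
The exceptional messages are null for the conjecture at `q`, which need not be the firm's actual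
messaging there. -/
lemma ae_buysBest_update (hc : 0 ≤ c) (hn : 0 < n) (i : Fin n) (q : ℝ≥0) :
    ∀ᵐ a ∂messageKernel μ (A.conj i) q, ∀ᵐ ω ∂Measure.pi (fun _ : Fin n => A.playLaw μ),
      A.BuysBest μ c (Function.update ω i (q, a)) := by
  have hp : ∀ j, IsProbabilityMeasure
      (Function.update (fun _ : Fin n => A.priceLaw) i (Measure.dirac q) j) := by
    intro j
    by_cases hj : j = i
    · subst hj; simp only [Function.update_self]; infer_instance
    · simp only [Function.update_of_ne hj]; infer_instance
  have h1 := hA.ae_buysBest hc hn (Function.update (fun _ => A.priceLaw) i (Measure.dirac q))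
  have h2 : (fun j => Function.update (fun _ : Fin n => A.priceLaw) i (Measure.dirac q) j ⊗ₘ
      messageKernel μ (A.conj j)) = Function.update (fun _ : Fin n => A.playLaw μ) i
        (Measure.dirac q ⊗ₘ messageKernel μ (A.conj i)) := by
    funext j
    by_cases hj : j = i
    · subst hj; simp
    · simp only [Function.update_of_ne hj, hA.playLaw_eq_conj j]
  rw [h2] at h1
  have h3 := ((measurePreserving_update_pi (fun _ : Fin n => A.playLaw μ) i
    (Measure.dirac q ⊗ₘ messageKernel μ (A.conj i))).comp
      Measure.measurePreserving_swap).quasiMeasurePreserving.ae h1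
  have h4 := Measure.ae_ae_of_ae_prod h3
  have h5 : Measure.dirac q ⊗ₘ messageKernel μ (A.conj i) =
      (messageKernel μ (A.conj i) q).map (Prod.mk q) := by
    ext s hs
    rw [Measure.dirac_compProd_apply hs, Measure.map_apply measurable_prodMk_left hs]
  rw [h5] at h4
  exact ae_of_ae_map measurable_prodMk_left.aemeasurable h4

end IsEquilibrium

end SymmetricAssessment

/-! ### Incentives of the firms. -/

namespace SymmetricAssessment

variable {n : ℕ} {M : Type*} [MeasurableSpace M] {A : SymmetricAssessment n M} {μ c : ℝ}
  [hμ : Fact (0 ≤ μ ∧ μ ≤ 1)]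

lemma measurable_saleProb (i : Fin n) :
    Measurable fun z : ℝ≥0 × M => A.saleProb μ i z.1 z.2 := by
  simp only [saleProb_eq_lintegral]
  refine Measurable.lintegral_prod_right' (f := fun x : (ℝ≥0 × M) × (Fin n → ℝ≥0 × M) =>
    (A.realizedSale i (Function.update x.2 i (x.1.1, x.1.2)) : ℝ≥0∞)) ?_
  exact ((A.measurable_realizedSale i).comp
    (measurable_update'.comp measurable_swap)).coe_nnreal_ennreal

lemma measurable_mul_saleProb (i : Fin n) :
    Measurable fun z : ℝ≥0 × M => (z.1 : ℝ≥0∞) * A.saleProb μ i z.1 z.2 :=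
  measurable_fst.coe_nnreal_ennreal.mul (measurable_saleProb i)

lemma saleProb_le_one (i : Fin n) (q : ℝ≥0) (a : M) : A.saleProb μ i q a ≤ 1 := by
  rw [saleProb_eq_lintegral]
  refine (lintegral_mono (g := fun _ => 1) fun ω => ?_).trans (by simp)
  simpa using A.realizedSale_le_one i _

lemma pi_setOf_forall_ne (ν : Measure (ℝ≥0 × M)) [IsProbabilityMeasure ν] (i : Fin n)
    (s : Fin n → Set (ℝ≥0 × M)) :
    Measure.pi (fun _ : Fin n => ν) {ω | ∀ j, j ≠ i → ω j ∈ s j} =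
      ∏ j ∈ Finset.univ.erase i, ν (s j) := by
  rw [← Measure.pi_pi_finset]
  congr 1
  ext ω
  simp [Set.mem_pi]

namespace IsEquilibrium

variable (hA : A.IsEquilibrium μ c) (hc : 0 ≤ c) (hn : 0 < n)
include hA hc hn

/-- A sale is certain only against strictly worse rivals; `ae_saleProb_le_measure` also admits ties.
The two bounds therefore combine across a strict gap in effective value, with no assumption on how
ties are broken. -/
lemma ae_measure_le_saleProb (i : Fin n) (q : ℝ≥0) :
    ∀ᵐ a ∂messageKernel μ (A.conj i) q, 0 < A.firmValue μ c i q a →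
      Measure.pi (fun _ : Fin n => A.playLaw μ)
        {ω | ∀ j, j ≠ i → A.firmValue μ c j (ω j).1 (ω j).2 < A.firmValue μ c i q a} ≤
      A.saleProb μ i q a := by
  filter_upwards [hA.ae_buysBest_update hc hn i q] with a ha h0
  have hm : MeasurableSet {ω : Fin n → ℝ≥0 × M | ∀ j, j ≠ i →
      A.firmValue μ c j (ω j).1 (ω j).2 < A.firmValue μ c i q a} := by
    simp only [Set.ofPred_forall]
    exact MeasurableSet.iInter fun j => MeasurableSet.iInter fun _ =>
      measurableSet_lt ((hA.measurable_firmValue hc j).comp (measurable_pi_apply j)) measurable_const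
  rw [saleProb_eq_lintegral, ← lintegral_indicator_one hm]
  refine lintegral_mono_ae ?_
  filter_upwards [ha] with ω hω
  by_cases hmem : ω ∈ {ω : Fin n → ℝ≥0 × M | ∀ j, j ≠ i →
      A.firmValue μ c j (ω j).1 (ω j).2 < A.firmValue μ c i q a}
  · rw [hω.2 i (by simpa using h0) fun j hj => by simpa [hj] using hmem j hj]
    simp [Set.indicator_of_mem hmem]
  · rw [Set.indicator_of_notMem hmem]
    exact zero_le

lemma ae_saleProb_le_measure (i : Fin n) (q : ℝ≥0) :
    ∀ᵐ a ∂messageKernel μ (A.conj i) q,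
      A.saleProb μ i q a ≤ Measure.pi (fun _ : Fin n => A.playLaw μ)
        {ω | ∀ j, j ≠ i → A.firmValue μ c j (ω j).1 (ω j).2 ≤ A.firmValue μ c i q a} ∧
      (A.firmValue μ c i q a < 0 → A.saleProb μ i q a = 0) := by
  filter_upwards [hA.ae_buysBest_update hc hn i q] with a ha
  refine ⟨?_, fun h0 => ?_⟩
  · have hm : MeasurableSet {ω : Fin n → ℝ≥0 × M | ∀ j, j ≠ i →
        A.firmValue μ c j (ω j).1 (ω j).2 ≤ A.firmValue μ c i q a} := by
      simp only [Set.ofPred_forall]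
      exact MeasurableSet.iInter fun j => MeasurableSet.iInter fun _ =>
        measurableSet_le ((hA.measurable_firmValue hc j).comp (measurable_pi_apply j))
          measurable_const
    rw [saleProb_eq_lintegral, ← lintegral_indicator_one hm]
    refine lintegral_mono_ae ?_
    filter_upwards [ha] with ω hω
    by_cases hmem : ω ∈ {ω : Fin n → ℝ≥0 × M | ∀ j, j ≠ i →
        A.firmValue μ c j (ω j).1 (ω j).2 ≤ A.firmValue μ c i q a}
    · rw [Set.indicator_of_mem hmem]
      simpa using A.realizedSale_le_one i _
    · rw [Set.indicator_of_notMem hmem]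
      have : A.realizedSale i (Function.update ω i (q, a)) = 0 := by
        by_contra hne
        refine hmem fun j hj => ?_
        simpa [hj] using (hω.1 i hne).2 j
      simp [this]
  · rw [saleProb_eq_lintegral]
    refine (lintegral_congr_ae ?_).trans lintegral_zero
    filter_upwards [ha] with ω hω
    have : A.realizedSale i (Function.update ω i (q, a)) = 0 := by
      by_contra hne
      have := (hω.1 i hne).1
      simp only [Function.update_self] at this
      linarith
    simp [this]

/-- Some message makes a firm with price `q` at least as attractive as the uninformative one. -/
lemma exists_measure_le_saleProb (i : Fin n) {q : ℝ≥0} {t : ℝ} (ht : 0 < t)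
    (htq : t + q ≤ μ - c) :
    ∃ a, Measure.pi (fun _ : Fin n => A.playLaw μ)
        {ω | ∀ j, j ≠ i → A.firmValue μ c j (ω j).1 (ω j).2 < t} ≤ A.saleProb μ i q a := by
  have hint : Integrable (A.firmValue μ c i q) (messageKernel μ (A.conj i) q) :=
    (isBoundedMeasurable_effectiveValue (A.measurable_belief i) (A.belief_mem i) q).integrable _
  -- Outside any null set, some message has effective value at least the mean `μ - c - q`.
  obtain ⟨a, ha, hle⟩ := exists_notMem_null_integral_le hint
    (ae_iff.1 (hA.ae_measure_le_saleProb hc hn i q))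
  rw [hA.integral_firmValue hc i q] at hle
  have hle' : t ≤ A.firmValue μ c i q a := by linarith
  refine ⟨a, le_trans (measure_mono ?_) (not_not.1 ha (ht.trans_le hle'))⟩
  intro ω hω j hj
  exact lt_of_lt_of_le (hω j hj) hle'

omit hc hn hμ in
-- Talk is cheap: what a price and message earn does not depend on the type, so each type can
-- imitate the other.
lemma profit_le_profit (i : Fin n) (x x' : Bool) : A.profit μ i x ≤ A.profit μ i x' := by
  calc A.profit μ i x ≤ ∫⁻ q, ∫⁻ a, A.profit μ i x' ∂(A.message (q, x)) ∂A.priceLaw :=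
        lintegral_mono fun q => lintegral_mono fun a => hA.firm_optimal i x' q a
    _ = A.profit μ i x' := by simp

omit hc hn in
lemma profit_le_lintegral (i : Fin n) :
    A.profit μ i true ≤ ∫⁻ z, (z.1 : ℝ≥0∞) * A.saleProb μ i z.1 z.2 ∂A.playLaw μ := by
  rw [playLaw_eq_compProd, Measure.lintegral_compProd (measurable_mul_saleProb i)]
  simp only [lintegral_messageKernel]
  refine le_trans ?_ (le_lintegral_add _ _)
  refine le_trans ?_ (add_le_add (lintegral_const_mul_le _ _) (lintegral_const_mul_le _ _))
  change _ ≤ ENNReal.ofReal μ * A.profit μ i true + ENNReal.ofReal (1 - μ) * A.profit μ i false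
  rw [le_antisymm (hA.profit_le_profit i false true) (hA.profit_le_profit i true false), ← add_mul,
    ofReal_add_ofReal_one_sub hμ.out.1 hμ.out.2, one_mul]

/-- A price above `1` exceeds every posterior and never sells. The finiteness of profits is what
`ae_mul_saleProb_eq` needs. -/
lemma profit_le_one (i : Fin n) : A.profit μ i true ≤ 1 := by
  refine (hA.profit_le_lintegral i).trans ?_
  rw [hA.playLaw_eq_conj i, Measure.lintegral_compProd (measurable_mul_saleProb i)]
  have : ∀ q, ∫⁻ a, (q : ℝ≥0∞) * A.saleProb μ i q a ∂messageKernel μ (A.conj i) q ≤ 1 := by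
    intro q
    refine (lintegral_mono_ae (g := fun _ => 1) ?_).trans (by simp)
    filter_upwards [hA.ae_saleProb_le_measure hc hn i q] with a ha
    rcases le_or_gt q 1 with hq | hq
    · exact mul_le_one' (by exact_mod_cast hq) (saleProb_le_one i q a)
    · have : A.firmValue μ c i q a < 0 := by
        refine lt_of_le_of_lt (min_le_left _ _) ?_
        have h1 := (A.belief_mem i q a).2
        have h2 : (1 : ℝ) < q := by exact_mod_cast hq
        linarith
      rw [ha.2 this]
      simp
  exact (lintegral_mono this).trans (by simp)

/-- No price and message earns more than the equilibrium profit, yet this is the average earned in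
play. -/
lemma ae_mul_saleProb_eq (i : Fin n) :
    ∀ᵐ z ∂A.playLaw μ, (z.1 : ℝ≥0∞) * A.saleProb μ i z.1 z.2 = A.profit μ i true := by
  refine ae_eq_of_ae_le_of_lintegral_le (g := fun _ => A.profit μ i true)
    (.of_forall fun z => hA.firm_optimal i true z.1 z.2) ?_ aemeasurable_const ?_
  · refine ne_top_of_le_ne_top ENNReal.one_ne_top ?_
    refine (lintegral_mono (g := fun _ => A.profit μ i true)
      fun z : ℝ≥0 × M => hA.firm_optimal i true z.1 z.2).trans ?_
    simpa using hA.profit_le_one hc hn i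
  · simpa using hA.profit_le_lintegral i

omit hc hn in
lemma ae_of_ae_playLaw (i : Fin n) {P : ℝ≥0 × M → Prop} (h : ∀ᵐ z ∂A.playLaw μ, P z) :
    ∀ᵐ q ∂A.priceLaw, ∀ᵐ a ∂messageKernel μ (A.conj i) q, P (q, a) := by
  rw [hA.playLaw_eq_conj i] at h
  exact Measure.ae_ae_of_ae_compProd h

/-- If profits are positive, information is useless at almost every price. -/
lemma ae_firmValue_eq_of_profit_ne_zero (i : Fin n) (hpos : A.profit μ i true ≠ 0) :
    ∀ᵐ z ∂A.playLaw μ, A.firmValue μ c i z.1 z.2 = μ - c - z.1 := by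
  have hw := hA.measurable_firmValue hc i
  have hsale := hA.ae_of_ae_playLaw i (hA.ae_mul_saleProb_eq hc hn i)
  rw [hA.playLaw_eq_conj i, Measure.ae_compProd_iff (measurableSet_eq_fun hw (by fun_prop))]
  filter_upwards [hsale] with q hq
  have hint : Integrable (A.firmValue μ c i q) (messageKernel μ (A.conj i) q) :=
    (isBoundedMeasurable_effectiveValue (A.measurable_belief i) (A.belief_mem i) q).integrable _
  have hle : ∀ᵐ a ∂messageKernel μ (A.conj i) q, μ - c - q ≤ A.firmValue μ c i q a := by
    by_contra hcon
    obtain ⟨a, ha, ⟨hsale, hup, hneg⟩⟩ :=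
      (Filter.Frequently.and_eventually (Filter.not_eventually.1 hcon)
        (hq.and (hA.ae_saleProb_le_measure hc hn i q))).exists
    replace ha := not_le.1 ha
    set w := A.firmValue μ c i q a
    have hs0 : A.saleProb μ i q a ≠ 0 := fun h => hpos (by rw [← hsale, h, mul_zero])
    have hw0 : 0 ≤ w := by
      by_contra h
      exact hs0 (hneg (not_le.1 h))
    -- Half of the gap goes to the price and half to the consumer: `(w + δ) + (q + δ) = μ - c`. Some
    -- message at price `q + δ` then has value at least `w + δ`, and sells at least as often as the
    -- original one.
    obtain ⟨δ, hδ⟩ : ∃ δ : ℝ≥0, (δ : ℝ) = (μ - c - q - w) / 2 :=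
      ⟨⟨(μ - c - q - w) / 2, by linarith⟩, rfl⟩
    obtain ⟨a', ha'⟩ := hA.exists_measure_le_saleProb hc hn i (q := q + δ) (t := w + δ)
      (by linarith) (by push_cast; linarith)
    have hmono : A.saleProb μ i q a ≤ A.saleProb μ i (q + δ) a' := by
      refine hup.trans ((measure_mono ?_).trans ha')
      intro ω hω j hj
      have hδ0 : (0 : ℝ) < δ := by linarith
      exact lt_of_le_of_lt (hω j hj) (by linarith)
    have hdev := hA.firm_optimal i true (q + δ) a'
    rw [← hsale] at hdev
    have h1 : ((q + δ : ℝ≥0) : ℝ≥0∞) * A.saleProb μ i q a ≤ q * A.saleProb μ i q a :=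
      (mul_le_mul_right hmono _).trans hdev
    have hne_top : A.saleProb μ i q a ≠ ∞ :=
      ne_top_of_le_ne_top ENNReal.one_ne_top (saleProb_le_one i q a)
    rw [ENNReal.mul_le_mul_iff_left hs0 hne_top] at h1
    have h2 : q + δ ≤ q := by exact_mod_cast h1
    have h3 : (q : ℝ) + δ ≤ q := by exact_mod_cast h2
    linarith
  have := (integral_eq_iff_of_ae_le (integrable_const (μ - c - (q : ℝ))) hint hle).1
    (by rw [hA.integral_firmValue hc i q]; simp)
  filter_upwards [this] with a ha
  exact ha.symm

omit hc hn in
-- Bayes' rule fixes the integral of the belief over every measurable set, hence the belief up to a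
-- null set.
lemma ae_belief_eq (i j : Fin n) {q : ℝ≥0}
    (hq : messageKernel μ (A.conj i) q = messageKernel μ (A.conj j) q)
    (hq' : A.conj i (q, true) = A.conj j (q, true)) :
    ∀ᵐ a ∂messageKernel μ (A.conj i) q, A.belief i q a = A.belief j q a := by
  refine Integrable.ae_eq_of_forall_setIntegral_eq _ _
    ((isBoundedMeasurable_belief (A.measurable_belief i) (A.belief_mem i) q).integrable _)
    ((isBoundedMeasurable_belief (A.measurable_belief j) (A.belief_mem j) q).integrable _)
    fun s hs _ => ?_
  have h1 := hA.bayes i q s hs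
  have h2 := hA.bayes j q s hs
  rw [← messageKernel_apply] at h1 h2
  rw [h1, hq, h2, hq']

omit hn in
lemma ae_firmValue_eq_firmValue (i j : Fin n) :
    ∀ᵐ z ∂A.playLaw μ, A.firmValue μ c i z.1 z.2 = A.firmValue μ c j z.1 z.2 := by
  rw [hA.playLaw_eq_conj i, Measure.ae_compProd_iff (measurableSet_eq_fun
    (hA.measurable_firmValue hc i) (hA.measurable_firmValue hc j))]
  filter_upwards [hA.conj_correct i, hA.conj_correct j] with q hi hj
  have hq : messageKernel μ (A.conj i) q = messageKernel μ (A.conj j) q := by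
    simp [messageKernel_apply, messageLaw, hi, hj]
  have hb := hA.ae_belief_eq i j hq ((hi true).trans (hj true).symm)
  have hr : reservationValue c (messageKernel μ (A.conj i)) (A.belief i) q =
      reservationValue c (messageKernel μ (A.conj j)) (A.belief j) q := by
    unfold reservationValue expectedExcess
    rw [← hq]
    congr 1
    ext U
    simp only [Set.mem_ofPred_eq]
    rw [integral_congr_ae]
    filter_upwards [hb] with a ha
    rw [ha]
  filter_upwards [hb] with a ha
  simp only [firmValue, effectiveValue, ha, hr]

end IsEquilibrium

end SymmetricAssessment

/-! ### Zero profits and price zero. -/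

namespace SymmetricAssessment

variable {n : ℕ} {M : Type*} [MeasurableSpace M] {A : SymmetricAssessment n M} {μ c : ℝ}
  [hμ : Fact (0 ≤ μ ∧ μ ≤ 1)]

/-- Averaging the sale probability over the firm's own play gives its ex ante sales. -/
lemma setLIntegral_saleProb (i : Fin n) {s : Set (ℝ≥0 × M)} (hs : MeasurableSet s) :
    ∫⁻ z in s, A.saleProb μ i z.1 z.2 ∂A.playLaw μ =
      ∫⁻ ω, s.indicator 1 (ω i) * (A.realizedSale i ω : ℝ≥0∞)
        ∂Measure.pi (fun _ : Fin n => A.playLaw μ) := by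
  have hF : Measurable fun ω : Fin n → ℝ≥0 × M =>
      s.indicator (1 : ℝ≥0 × M → ℝ≥0∞) (ω i) * (A.realizedSale i ω : ℝ≥0∞) :=
    ((measurable_one.indicator hs).comp (measurable_pi_apply i)).mul
      (A.measurable_realizedSale i).coe_nnreal_ennreal
  have hmp := measurePreserving_update_pi (fun _ : Fin n => A.playLaw μ) i (A.playLaw μ)
  rw [Function.update_eq_self i (fun _ : Fin n => A.playLaw μ)] at hmp
  have hF' := hF.comp hmp.measurable
  simp only [Function.comp_def] at hF'
  rw [← hmp.lintegral_comp hF, lintegral_prod_symm' _ hF', ← lintegral_indicator hs]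
  refine lintegral_congr fun z => ?_
  simp only [Function.update_self]
  by_cases hz : z ∈ s
  · simp [hz, saleProb_eq_lintegral]
  · simp [hz]

namespace IsEquilibrium

variable (hA : A.IsEquilibrium μ c) (hc : 0 ≤ c)
include hA hc

lemma mul_prod_le_profit (hn : 0 < n) (i : Fin n) {q : ℝ≥0} {t : ℝ} (ht : 0 < t)
    (htq : t + q ≤ μ - c) :
    (q : ℝ≥0∞) * ∏ j ∈ Finset.univ.erase i,
      A.playLaw μ {z | A.firmValue μ c j z.1 z.2 < t} ≤ A.profit μ i true := by
  obtain ⟨a, ha⟩ := hA.exists_measure_le_saleProb hc hn i ht htq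
  rw [← pi_setOf_forall_ne]
  exact (mul_le_mul_right ha _).trans (hA.firm_optimal i true q a)

/-- With zero profits nobody can be less attractive than an uninformative firm with price 0. -/
lemma ae_le_firmValue_of_profit_eq_zero (hn : 0 < n) (hcμ : c < μ) (i : Fin n)
    (h0 : A.profit μ i true = 0) :
    ∀ᵐ z ∂A.playLaw μ, μ - c ≤ A.firmValue μ c i z.1 z.2 := by
  -- Deviate to the price `ε = (μ - c) / (m + 2)` with value at least `μ - c - ε`, which the `+ 2`
  -- keeps positive. Zero profit means that some rival is almost surely at least that attractive,
  -- and effective values do not depend on the firm's name.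
  have key : ∀ m : ℕ, ∀ᵐ z ∂A.playLaw μ,
      (μ - c) - (μ - c) / (m + 2) ≤ A.firmValue μ c i z.1 z.2 := by
    intro m
    have hm : (0 : ℝ) < (μ - c) / (m + 2) := div_pos (by linarith) (by positivity)
    have hm2 : (μ - c) / (m + 2) < μ - c :=
      div_lt_self (by linarith) (by linarith [(Nat.cast_nonneg m : (0 : ℝ) ≤ m)])
    obtain ⟨q, hq⟩ : ∃ q : ℝ≥0, (q : ℝ) = (μ - c) / (m + 2) := ⟨⟨_, hm.le⟩, rfl⟩
    have h1 := hA.mul_prod_le_profit hc hn i (q := q)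
      (t := (μ - c) - (μ - c) / (m + 2)) (by linarith) (by linarith)
    rw [h0, nonpos_iff_eq_zero, mul_eq_zero, Finset.prod_eq_zero_iff] at h1
    rcases h1 with h1 | ⟨j, -, hj⟩
    · exfalso
      rw [ENNReal.coe_eq_zero] at h1
      rw [← hq, h1] at hm
      simp at hm
    · have h2 : ∀ᵐ z ∂A.playLaw μ, ¬ A.firmValue μ c j z.1 z.2 < (μ - c) - (μ - c) / (m + 2) := by
        rw [ae_iff]
        simpa only [not_not] using hj
      filter_upwards [h2, hA.ae_firmValue_eq_firmValue hc i j] with z hz hij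
      rw [hij]
      exact not_lt.1 hz
  filter_upwards [ae_all_iff.2 key] with z hz
  by_contra hcon
  push Not at hcon
  obtain ⟨m, hm⟩ := exists_nat_one_div_lt
    (show 0 < (μ - c - A.firmValue μ c i z.1 z.2) / (μ - c) from
      div_pos (by linarith) (by linarith))
  have h1 : (μ - c) / (m + 2) < μ - c - A.firmValue μ c i z.1 z.2 := by
    calc (μ - c) / (m + 2) ≤ (μ - c) * (1 / (m + 1)) := by
          rw [mul_one_div]
          exact div_le_div_of_nonneg_left (by linarith) (by positivity) (by linarith)
      _ < (μ - c) * ((μ - c - A.firmValue μ c i z.1 z.2) / (μ - c)) :=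
          mul_lt_mul_of_pos_left hm (by linarith)
      _ = _ := mul_div_cancel₀ _ (by linarith)
  linarith [hz m]

/-- Undercutting rules out positive profits when information is useless at all prices. -/
lemma profit_eq_zero (hn : 2 ≤ n) (i : Fin n) : A.profit μ i true = 0 := by
  by_contra hpos
  have hn0 : 0 < n := by omega
  set P := A.playLaw μ with hP
  have hval : ∀ᵐ z ∂P, ∀ j, A.firmValue μ c j z.1 z.2 = μ - c - z.1 := by
    refine ae_all_iff.2 fun j => ?_
    filter_upwards [hA.ae_firmValue_eq_of_profit_ne_zero hc hn0 i hpos,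
      hA.ae_firmValue_eq_firmValue hc i j] with z h1 h2
    rw [← h2, h1]
  have hsale : ∀ᵐ z ∂P, (z.1 : ℝ≥0∞) * A.saleProb μ i z.1 z.2 = A.profit μ i true :=
    hA.ae_mul_saleProb_eq hc hn0 i
  have hpricepos : ∀ᵐ z ∂P, 0 < z.1 := by
    filter_upwards [hsale] with z hz
    rw [pos_iff_ne_zero]
    intro h
    exact hpos (by rw [← hz, h]; simp)
  have hneg : ∀ᵐ z ∂P, A.firmValue μ c i z.1 z.2 < 0 → A.saleProb μ i z.1 z.2 = 0 := by
    have hm : MeasurableSet {z : ℝ≥0 × M |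
        A.firmValue μ c i z.1 z.2 < 0 → A.saleProb μ i z.1 z.2 = 0} :=
      (measurableSet_lt (hA.measurable_firmValue hc i) measurable_const).imp
        (measurableSet_eq_fun (measurable_saleProb i) measurable_const)
    rw [hP, hA.playLaw_eq_conj i, Measure.ae_compProd_iff hm]
    refine .of_forall fun q => ?_
    filter_upwards [hA.ae_saleProb_le_measure hc hn0 i q] with a ha
    exact ha.2
  have hpricele : ∀ᵐ z ∂P, (z.1 : ℝ) ≤ μ - c := by
    filter_upwards [hsale, hneg, hval] with z h1 h2 h3
    by_contra h
    refine hpos ?_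
    rw [← h1, h2 (by rw [h3 i]; linarith), mul_zero]
  -- `g t` is the probability that a rival's price exceeds `t`.
  set g : ℝ≥0 → ℝ≥0∞ := fun t => P {z | t < z.1} with hg
  have hS : ∀ t : ℝ≥0, MeasurableSet {z : ℝ≥0 × M | t < z.1} := fun t =>
    measurableSet_lt measurable_const measurable_fst
  have hgzero : ∀ t, g t = 0 ↔ ∀ᵐ z ∂P, z.1 ≤ t := by
    intro t
    rw [ae_iff]
    simp [hg]
  obtain ⟨t₀, ht₀, hgt₀⟩ : ∃ t₀ : ℝ≥0, 0 < t₀ ∧ g t₀ ≠ 0 := by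
    by_contra! hcon
    have h1 : ∀ᵐ z ∂P, ∀ m : ℕ, z.1 ≤ 1 / ((m : ℝ≥0) + 1) :=
      ae_all_iff.2 fun m => (hgzero _).1 (hcon _ (by positivity))
    have h2 : ∀ᵐ z ∂P, False := by
      filter_upwards [h1, hpricepos] with z hz hz0
      obtain ⟨m, hm⟩ := exists_nat_one_div_lt hz0
      exact absurd (hz m) (not_le.2 hm)
    exact (IsProbabilityMeasure.ne_zero P) (by simpa using h2)
  have hex : ∃ m : ℕ, g (t₀ * (3 / 2) ^ m) = 0 := by
    obtain ⟨m, hm⟩ := pow_unbounded_of_one_lt ((μ - c) / t₀) (show (1 : ℝ) < 3 / 2 by norm_num)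
    refine ⟨m, (hgzero _).2 ?_⟩
    have ht₀' : (0 : ℝ) < t₀ := by exact_mod_cast ht₀
    filter_upwards [hpricele] with z hz
    rw [div_lt_iff₀ ht₀'] at hm
    rw [← NNReal.coe_le_coe]
    push_cast
    linarith
  classical
  -- Posted prices are positive and bounded, so along `t₀ * (3 / 2) ^ m` there is a last point
  -- exceeded with positive probability. Almost all prices are then at most `3 / 2` times this `t`.
  obtain ⟨t, ht0, hgt, hgt'⟩ : ∃ t : ℝ≥0, 0 < t ∧ g t ≠ 0 ∧ g (t * (3 / 2)) = 0 := by
    have hspec := Nat.find_spec hex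
    cases hm : Nat.find hex with
    | zero =>
      rw [hm] at hspec
      exact absurd (by simpa using hspec) hgt₀
    | succ m =>
      rw [hm] at hspec
      refine ⟨t₀ * (3 / 2) ^ m, by positivity, Nat.find_min hex (by omega), ?_⟩
      rw [mul_assoc, ← pow_succ]
      exact hspec
  have hgtop : g t ≠ ∞ := measure_ne_top _ _
  have htE : (t : ℝ) < μ - c := by
    by_contra hcon
    refine hgt ((hgzero t).2 ?_)
    filter_upwards [hpricele] with z hz
    rw [← NNReal.coe_le_coe]
    linarith
  -- Charging `t` secures a sale whenever all rivals charge more.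
  have hprofit : ∀ j, (t : ℝ≥0∞) * g t ^ (n - 1) ≤ A.profit μ j true := by
    intro j
    have h1 := hA.mul_prod_le_profit hc hn0 j (q := t) (t := μ - c - t) (by linarith) (by linarith)
    have h2 : ∀ k, A.playLaw μ {z | A.firmValue μ c k z.1 z.2 < μ - c - t} = g t := by
      intro k
      refine measure_congr (Filter.eventuallyEq_set.2 ?_)
      filter_upwards [hval] with z hz
      simp only [hz k]
      rw [← NNReal.coe_lt_coe]
      constructor <;> intro h <;> linarith
    simp only [h2, Finset.prod_const] at h1
    rwa [Finset.card_erase_of_mem (Finset.mem_univ j), Finset.card_univ, Fintype.card_fin] at h1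
  -- Every posted price is at most `3 / 2 * t` and earns at least `t * g t ^ (n - 1)`, so it sells
  -- with probability at least `2 / 3 * g t ^ (n - 1)`. Average over own prices above `t`.
  have hlower : ∀ j, 2 * g t ^ n ≤ 3 * ∫⁻ z in {z | t < z.1}, A.saleProb μ j z.1 z.2 ∂P := by
    intro j
    have h1 : ∀ᵐ z ∂P, 2 * g t ^ (n - 1) ≤ 3 * A.saleProb μ j z.1 z.2 := by
      filter_upwards [hA.ae_mul_saleProb_eq hc hn0 j, (hgzero _).1 hgt'] with z hz hzt
      have h2 : (2 : ℝ≥0∞) * z.1 ≤ 3 * t := by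
        have : 2 * z.1 ≤ 3 * t := by
          rw [← NNReal.coe_le_coe] at hzt ⊢
          push_cast at hzt ⊢
          linarith
        exact_mod_cast this
      have h3 : (t : ℝ≥0∞) * (2 * g t ^ (n - 1)) ≤ t * (3 * A.saleProb μ j z.1 z.2) :=
        calc (t : ℝ≥0∞) * (2 * g t ^ (n - 1)) = 2 * (t * g t ^ (n - 1)) := by ring
          _ ≤ 2 * (z.1 * A.saleProb μ j z.1 z.2) := by rw [hz]; gcongr; exact hprofit j
          _ = (2 * z.1) * A.saleProb μ j z.1 z.2 := by ring
          _ ≤ (3 * t) * A.saleProb μ j z.1 z.2 := by gcongr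
          _ = t * (3 * A.saleProb μ j z.1 z.2) := by ring
      rwa [ENNReal.mul_le_mul_iff_right (by exact_mod_cast ht0.ne') ENNReal.coe_ne_top] at h3
    calc 2 * g t ^ n = 2 * g t ^ (n - 1) * g t := by
          rw [mul_assoc, ← pow_succ, Nat.sub_add_cancel hn0]
      _ = ∫⁻ z in {z | t < z.1}, 2 * g t ^ (n - 1) ∂P := by rw [setLIntegral_const]
      _ ≤ ∫⁻ z in {z | t < z.1}, 3 * A.saleProb μ j z.1 z.2 ∂P :=
          lintegral_mono_ae (ae_restrict_of_ae h1)
      _ = _ := lintegral_const_mul _ (measurable_saleProb j)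
  -- The consumer buys at the lowest price, so a sale above `t` requires all `n` prices to exceed
  -- `t`, and at most one unit is sold.
  have hupper : ∑ j, ∫⁻ z in {z | t < z.1}, A.saleProb μ j z.1 z.2 ∂P ≤ g t ^ n := by
    have hmeas : ∀ j, Measurable fun ω : Fin n → ℝ≥0 × M =>
        {z : ℝ≥0 × M | t < z.1}.indicator (1 : ℝ≥0 × M → ℝ≥0∞) (ω j) *
          (A.realizedSale j ω : ℝ≥0∞) := fun j =>
      ((measurable_one.indicator (hS t)).comp (measurable_pi_apply j)).mul
        (A.measurable_realizedSale j).coe_nnreal_ennreal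
    have hbox : g t ^ n = Measure.pi (fun _ : Fin n => P)
        (Set.univ.pi fun _ => {z : ℝ≥0 × M | t < z.1}) := by
      rw [Measure.pi_pi]; simp [hg]
    simp only [hP, setLIntegral_saleProb _ (hS t)]
    rw [← lintegral_finsetSum _ fun j _ => hmeas j, hbox,
      ← lintegral_indicator_one (MeasurableSet.univ_pi fun _ => hS t)]
    have hval' : ∀ᵐ ω ∂Measure.pi (fun _ : Fin n => P), ∀ j,
        A.firmValue μ c j (ω j).1 (ω j).2 = μ - c - (ω j).1 := by
      refine ae_all_iff.2 fun j => ?_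
      exact (Measure.quasiMeasurePreserving_eval (fun _ : Fin n => P) j).ae
        (hval.mono fun z hz => hz j)
    refine lintegral_mono_ae ?_
    filter_upwards [hA.ae_buysBest_playLaw hc hn0, hval'] with ω hω hv
    by_cases hall : ω ∈ Set.univ.pi fun _ : Fin n => {z : ℝ≥0 × M | t < z.1}
    · rw [Set.indicator_of_mem hall]
      have h1 : ∑ j, (A.realizedSale j ω : ℝ≥0∞) ≤ 1 := by
        exact_mod_cast A.sum_realizedSale_le_one ω
      refine le_trans (Finset.sum_le_sum fun j _ => ?_) h1
      rw [Set.indicator_of_mem (hall j (Set.mem_univ j))]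
      simp
    · rw [Set.indicator_of_notMem hall]
      refine (Finset.sum_eq_zero fun j _ => ?_).le
      simp only [Set.mem_univ_pi, Set.mem_ofPred_eq, not_forall, not_lt] at hall
      obtain ⟨k, hk⟩ := hall
      by_cases hj : t < (ω j).1
      · have : A.realizedSale j ω = 0 := by
          by_contra hne
          have h1 := (hω.1 j hne).2 k
          rw [hv j, hv k] at h1
          have h2 : (t : ℝ) < (ω j).1 := by exact_mod_cast hj
          have h3 : ((ω k).1 : ℝ) ≤ t := by exact_mod_cast hk
          linarith
        simp [this]
      · have : ω j ∉ {z : ℝ≥0 × M | t < z.1} := hj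
        rw [Set.indicator_of_notMem this, zero_mul]
  -- Summing over firms gives `2 * n ≤ 3`; the factor `3 / 2` was chosen below `2` to contradict `n
  -- ≥ 2`.
  have hfinal : (n : ℝ≥0∞) * 2 * g t ^ n ≤ 3 * g t ^ n := by
    calc (n : ℝ≥0∞) * 2 * g t ^ n = ∑ _j : Fin n, 2 * g t ^ n := by simp [mul_assoc]
      _ ≤ ∑ j : Fin n, 3 * ∫⁻ z in {z | t < z.1}, A.saleProb μ j z.1 z.2 ∂P :=
          Finset.sum_le_sum fun j _ => hlower j
      _ = 3 * ∑ j : Fin n, ∫⁻ z in {z | t < z.1}, A.saleProb μ j z.1 z.2 ∂P :=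
          (Finset.mul_sum _ _ _).symm
      _ ≤ 3 * g t ^ n := by gcongr
  rw [ENNReal.mul_le_mul_iff_left (pow_ne_zero _ hgt) (ENNReal.pow_ne_top hgtop)] at hfinal
  have : n * 2 ≤ 3 := by exact_mod_cast hfinal
  omega

/-- In equilibrium all firms post the price zero. -/
lemma priceLaw_eq_dirac (hn : 2 ≤ n) (hcμ : c < μ) : A.priceLaw = Measure.dirac 0 := by
  have hn0 : 0 < n := by omega
  let i : Fin n := ⟨0, hn0⟩
  have h := hA.ae_of_ae_playLaw i
    (hA.ae_le_firmValue_of_profit_eq_zero hc hn0 hcμ i (hA.profit_eq_zero hc hn i))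
  have hq : ∀ᵐ q ∂A.priceLaw, id q = (0 : ℝ≥0) := by
    filter_upwards [h] with q hq
    have hint : Integrable (A.firmValue μ c i q) (messageKernel μ (A.conj i) q) :=
      (isBoundedMeasurable_effectiveValue (A.measurable_belief i) (A.belief_mem i) q).integrable _
    -- The effective value is at least `μ - c` but has mean `μ - c - q`.
    have h1 := integral_mono_ae (integrable_const (μ - c)) hint hq
    rw [hA.integral_firmValue hc i q] at h1
    simp only [integral_const, probReal_univ, one_smul] at h1
    have h2 : (q : ℝ) ≤ 0 := by linarith
    exact le_antisymm (by exact_mod_cast h2) zero_le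
  calc A.priceLaw = A.priceLaw.map id := Measure.map_id.symm
    _ = A.priceLaw.map fun _ => 0 := Measure.map_congr hq
    _ = Measure.dirac 0 := by simp

lemma ae_posteriorLaw_mem (hn : 2 ≤ n) (hcμ : c < μ) (i : Fin n) :
    IsProbabilityMeasure (A.posteriorLaw μ i 0) ∧
    (∀ᵐ x ∂A.posteriorLaw μ i 0, x ∈ Set.Icc (μ - c) 1) ∧
      ∫ x, x ∂A.posteriorLaw μ i 0 = μ := by
  have hn0 : 0 < n := by omega
  have h := hA.ae_of_ae_playLaw i
    (hA.ae_le_firmValue_of_profit_eq_zero hc hn0 hcμ i (hA.profit_eq_zero hc hn i))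
  have hconj := hA.conj_correct i
  rw [hA.priceLaw_eq_dirac hc hn hcμ, ae_dirac_eq, Filter.eventually_pure] at h hconj
  have hb : Measurable (A.belief i 0) := (A.measurable_belief i).comp measurable_prodMk_left
  have hF : A.posteriorLaw μ i 0 = (messageKernel μ (A.conj i) 0).map (A.belief i 0) := by
    simp [posteriorLaw, messageKernel_apply, messageLaw, hconj]
  rw [hF]
  refine ⟨Measure.isProbabilityMeasure_map hb.aemeasurable, ?_, ?_⟩
  · refine (ae_map_iff (p := fun x => x ∈ Set.Icc (μ - c) 1) hb.aemeasurable measurableSet_Icc).2 ?_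
    filter_upwards [h] with a ha
    refine ⟨ha.trans ((min_le_left _ _).trans (by simp)), (A.belief_mem i 0 a).2⟩
  · rw [integral_map hb.aemeasurable (by fun_prop)]
    exact hA.integral_belief i 0

end IsEquilibrium

end SymmetricAssessment

/-! ### Consequences for the posterior distribution. -/

section UselessInformation

variable {μ c : ℝ} {F : Measure ℝ} [IsProbabilityMeasure F]

omit [IsProbabilityMeasure F] in
lemma uselessInformation_of_ae (h : ∀ᵐ x ∂F, x ∈ Set.Icc (μ - c) 1) :
    UselessInformation μ c F :=
  Measure.support_subset_of_isClosed isClosed_Icc h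

lemma isReservationValue_of_ae (h : ∀ᵐ x ∂F, x ∈ Set.Icc (μ - c) 1) (hmean : ∫ x, x ∂F = μ) :
    IsReservationValue c F 0 (μ - c) := by
  have hint : Integrable (fun x : ℝ => x) F :=
    Integrable.of_mem_Icc (μ - c) 1 aemeasurable_id h
  rw [IsReservationValue, NNReal.coe_zero, add_zero, Measure.restrict_eq_self_of_ae_mem h]
  simp only [sub_zero]
  rw [integral_sub hint (integrable_const _), hmean]
  simp

lemma effectiveLaw_eq_dirac_of_ae (h : ∀ᵐ x ∂F, x ∈ Set.Icc (μ - c) 1) (hmean : ∫ x, x ∂F = μ)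
    {U : ℝ} (hU : IsReservationValue c F 0 U) :
    effectiveLaw F 0 U = Measure.dirac (μ - c) := by
  have hint : Integrable (fun x : ℝ => x) F :=
    Integrable.of_mem_Icc (μ - c) 1 aemeasurable_id h
  have hmin : Integrable (fun x : ℝ => min x U) F := hint.inf (integrable_const U)
  have hmean' : ∫ x, min x U ∂F = μ - c := by
    rw [IsReservationValue, NNReal.coe_zero, add_zero, ← integral_indicator measurableSet_Icc] at hU
    have h1 : ∀ᵐ x ∂F, (Set.Icc U 1).indicator (fun x => x - 0 - U) x = x - min x U := by
      filter_upwards [h] with x hx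
      by_cases hxU : U ≤ x
      · rw [Set.indicator_of_mem (show x ∈ Set.Icc U 1 from ⟨hxU, hx.2⟩), min_eq_right hxU, sub_zero]
      · rw [Set.indicator_of_notMem (fun h => hxU h.1), min_eq_left (not_le.1 hxU).le, sub_self]
    rw [integral_congr_ae h1, integral_sub hint hmin, hmean] at hU
    linarith
  have hae : ∀ᵐ x ∂F, min x U = μ - c := by
    -- `min x U` has mean `μ - c`. If `U` is at least that number, so is `min x U`, which is then
    -- constant; a smaller `U` would make the mean too small.
    rcases le_or_gt (μ - c) U with hle | hlt
    · have hle' : ∀ᵐ x ∂F, μ - c ≤ min x U := h.mono fun x hx => le_min hx.1 hle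
      have := (integral_eq_iff_of_ae_le (integrable_const (μ - c)) hmin hle').1
        (by rw [hmean']; simp)
      filter_upwards [this] with x hx
      exact hx.symm
    · exfalso
      have : ∫ x, min x U ∂F ≤ ∫ _, U ∂F :=
        integral_mono hmin (integrable_const _) fun x => min_le_right _ _
      rw [hmean'] at this
      simp only [integral_const, probReal_univ, one_smul] at this
      linarith
  have hae' : (fun x : ℝ => min (x - ((0 : ℝ≥0) : ℝ)) U) =ᵐ[F] fun _ => μ - c := by
    filter_upwards [hae] with x hx
    simpa using hx
  rw [effectiveLaw, Measure.map_congr hae', Measure.map_const]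
  simp

end UselessInformation

/-! ### Search without information. -/

section Babbling

variable {n : ℕ} {M : Type*} [MeasurableSpace M]

/-- The consumer's best option when every firm has expected match value `μ`. -/
def uninformedValue (μ c : ℝ) (p : Fin n → ℝ≥0) (L : List (Fin n)) : ℝ :=
  Finset.univ.fold max 0 fun i => if i ∈ L then μ - p i else μ - c - p i

/-- Weitzman's strategy when every firm has expected match value `μ`. -/
def uninformedSearch (n : ℕ) (M : Type*) [MeasurableSpace M] (μ c : ℝ) : SearchStrategy n M :=
  indexStrategy (fun _ q _ => μ - q) (fun _ q => μ - c - q) (fun _ => by fun_prop)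
    fun _ => by fun_prop

variable {μ c : ℝ}

lemma uninformedValue_nonneg (p : Fin n → ℝ≥0) (L : List (Fin n)) :
    0 ≤ uninformedValue μ c p L :=
  ((Finset.fold_max_le _).1 le_rfl).1

lemma le_uninformedValue (p : Fin n → ℝ≥0) (L : List (Fin n)) (i : Fin n) :
    (if i ∈ L then μ - p i else μ - c - p i) ≤ uninformedValue μ c p L := by
  have h := le_refl (uninformedValue μ c p L)
  conv_lhs at h => unfold uninformedValue
  exact ((Finset.fold_max_le _).1 h).2 i (Finset.mem_univ i)

lemma uninformedValue_cons_le (hc : 0 ≤ c) (p : Fin n → ℝ≥0) (L : List (Fin n)) (j : Fin n) :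
    uninformedValue μ c p (j :: L) ≤ uninformedValue μ c p L + c := by
  refine (Finset.fold_max_le _).2 ⟨add_nonneg (uninformedValue_nonneg p L) hc, fun i _ => ?_⟩
  have h := le_uninformedValue (μ := μ) (c := c) p L i
  by_cases hi : i ∈ L
  · simp only [hi, if_true] at h
    simp only [List.mem_cons, hi, or_true, if_true]
    linarith
  · simp only [hi, if_false] at h
    by_cases hij : i = j
    · simp only [List.mem_cons, hij, true_or, if_true]
      rw [hij] at h
      linarith
    · simp only [List.mem_cons, hij, hi, or_self, if_false]
      linarith

variable {conj : Fin n → Kernel (ℝ≥0 × Bool) M}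
  [∀ j q, IsProbabilityMeasure (messageLaw μ (conj j) q)]

/-- A visit costs `c` and raises the best option by at most `c`, so `uninformedValue` is a
supersolution of the Bellman equation. -/
lemma SearchStrategy.payoff_le_uninformedValue (t : SearchStrategy n M) (hc : 0 ≤ c)
    (p : Fin n → ℝ≥0) (k : ℕ) (L : List (Fin n)) (m : Fin n → M) :
    t.payoff μ c conj (fun _ _ _ => μ) p k L m ≤ uninformedValue μ c p L := by
  have hbuy : ∀ L m i, (t.buy p L m i : ℝ) * (μ - p i) ≤
      t.buy p L m i * uninformedValue μ c p L := by
    intro L m i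
    by_cases hi : i ∈ L
    · have h := le_uninformedValue (μ := μ) (c := c) p L i
      simp only [hi, if_true] at h
      gcongr
    · simp [t.buy_unvisited p L m i hi]
  have hsum : ∀ L m, ∑ i, (t.visit p L m i : ℝ) + ∑ i, (t.buy p L m i : ℝ) ≤ 1 := fun L m => by
    exact_mod_cast t.sum_le_one p L m
  induction k generalizing L m with
  | zero =>
    refine (Finset.sum_le_sum fun i _ => hbuy L m i).trans ?_
    rw [← Finset.sum_mul]
    refine mul_le_of_le_one_left (uninformedValue_nonneg p L) ?_
    exact (le_add_of_nonneg_left (Finset.sum_nonneg fun _ _ => NNReal.coe_nonneg _)).trans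
      (hsum L m)
  | succ k ih =>
    have hvisit : ∀ j, (t.visit p L m j : ℝ) * (-c + ∫ a, t.payoff μ c conj (fun _ _ _ => μ) p k
        (j :: L) (Function.update m j a) ∂messageLaw μ (conj j) (p j)) ≤
        t.visit p L m j * uninformedValue μ c p L := by
      intro j
      gcongr
      have h1 : ∫ a, t.payoff μ c conj (fun _ _ _ => μ) p k (j :: L) (Function.update m j a)
          ∂messageLaw μ (conj j) (p j) ≤ uninformedValue μ c p (j :: L) := by
        by_cases hint : Integrable (fun a => t.payoff μ c conj (fun _ _ _ => μ) p k (j :: L)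
            (Function.update m j a)) (messageLaw μ (conj j) (p j))
        · refine (integral_mono hint (integrable_const (uninformedValue μ c p (j :: L)))
            fun a => ih _ _).trans ?_
          simp
        -- A non-integrable continuation has integral `0` by convention, and the bound is
        -- nonnegative.
        · rw [integral_undef hint]
          exact uninformedValue_nonneg p _
      linarith [uninformedValue_cons_le (μ := μ) hc p L j]
    refine (add_le_add (Finset.sum_le_sum fun i _ => hbuy L m i)
      (Finset.sum_le_sum fun j _ => hvisit j)).trans ?_
    rw [← Finset.sum_mul, ← Finset.sum_mul, ← add_mul, add_comm]
    exact mul_le_of_le_one_left (uninformedValue_nonneg p L) (hsum L m)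

/-- Whenever the index strategy visits a firm, the best option rises by exactly `c`, so the Bellman
inequality is tight along it. -/
lemma payoff_uninformedSearch (hn : 0 < n) (hc : 0 ≤ c) (p : Fin n → ℝ≥0) (k : ℕ)
    (L : List (Fin n)) (hL : L.Nodup) (hk : k + L.length = n) (m : Fin n → M) :
    (uninformedSearch n M μ c).payoff μ c conj (fun _ _ _ => μ) p k L m =
      uninformedValue μ c p L := by
  have hV : ∀ L i, 0 < (if i ∈ L then μ - p i else μ - c - p i) →
      (∀ j, (if j ∈ L then μ - p j else μ - c - p j) ≤
        if i ∈ L then μ - p i else μ - c - p i) →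
      uninformedValue μ c p L = if i ∈ L then μ - p i else μ - c - p i := fun L i h0 h =>
    le_antisymm ((Finset.fold_max_le _).2 ⟨h0.le, fun j _ => h j⟩) (le_uninformedValue p L i)
  have hcases := indexStrategy_cases (M := M) (v := fun _ q _ => μ - q) (U := fun _ q => μ - c - q)
    (hv := fun _ => by fun_prop) (hU := fun _ => by fun_prop) hn p
  simp only [searchIndex] at hcases
  have hquit : ∀ L, (∀ j, (if j ∈ L then μ - p j else μ - c - p j) ≤ 0) →
      uninformedValue μ c p L = 0 := fun L h =>
    le_antisymm ((Finset.fold_max_le _).2 ⟨le_rfl, fun j _ => h j⟩) (uninformedValue_nonneg p L)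
  induction k generalizing L m with
  | zero =>
    rcases hcases L m with ⟨h0, -, hb⟩ | ⟨i, h0, hi, ⟨hiL, -, hb⟩ | ⟨hiL, -, hb⟩⟩
    · rw [hquit L h0]
      simp [SearchStrategy.payoff, uninformedSearch, hb]
    · rw [hV L i h0 hi, if_pos hiL]
      simp only [SearchStrategy.payoff, uninformedSearch, hb]
      rw [Finset.sum_eq_single i (fun j _ hj => by simp [hj]) (by simp)]
      simp
    · have h1 : L.toFinset = Finset.univ := by
        rw [← Finset.card_eq_iff_eq_univ, List.toFinset_card_of_nodup hL, Fintype.card_fin]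
        omega
      exact absurd (List.mem_toFinset.1 (h1 ▸ Finset.mem_univ i)) hiL
  | succ k ih =>
    rcases hcases L m with ⟨h0, hvis, hb⟩ | ⟨i, h0, hi, ⟨hiL, hvis, hb⟩ | ⟨hiL, hvis, hb⟩⟩
    · rw [hquit L h0]
      simp [SearchStrategy.payoff, uninformedSearch, hb, hvis]
    · rw [hV L i h0 hi, if_pos hiL]
      simp only [SearchStrategy.payoff]
      rw [uninformedSearch, hb, hvis,
        Finset.sum_eq_single i (fun j _ hj => by simp [hj]) (by simp)]
      simp
    · have hnext : ∀ a, (uninformedSearch n M μ c).payoff μ c conj (fun _ _ _ => μ) p k (i :: L)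
          (Function.update m i a) = uninformedValue μ c p (i :: L) := fun a =>
        ih (i :: L) (List.nodup_cons.2 ⟨hiL, hL⟩) (by simp only [List.length_cons]; omega) _
      have hval : uninformedValue μ c p (i :: L) = μ - p i := by
        have := hV (i :: L) i
        simp only [hiL, if_false] at h0 hi
        simp only [List.mem_cons, true_or, if_true] at this
        refine this (by linarith) fun j => ?_
        have hj := hi j
        by_cases hjL : j ∈ L
        · simp only [hjL, if_true] at hj
          simp only [hjL, or_true, if_true]
          linarith
        · simp only [hjL, if_false] at hj
          by_cases hji : j = i
          · simp [hji]
          · simp only [hjL, hji, or_self, if_false]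
            linarith
      have hvis' : (uninformedSearch n M μ c).visit p L m = Pi.single i 1 := hvis
      have hb' : (uninformedSearch n M μ c).buy p L m = 0 := hb
      rw [hV L i h0 hi, if_neg hiL]
      simp only [SearchStrategy.payoff, hb', hvis']
      rw [Finset.sum_eq_single (a := i) (s := Finset.univ)
        (f := fun j => ((Pi.single i 1 : Fin n → ℝ≥0) j : ℝ) * _)
        (fun j _ hj => by simp [hj]) (by simp)]
      simp only [hnext, hval, integral_const, probReal_univ, one_smul]
      simp
      ring

omit [∀ j q, IsProbabilityMeasure (messageLaw μ (conj j) q)] in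
/-- An uninformed consumer never visits a firm that is undercut. -/
lemma buyProb_uninformedSearch_eq_zero {p : Fin n → ℝ≥0} {i j : Fin n} (hc : 0 ≤ c)
    (hij : p j < p i) (m : Fin n → M) (k : ℕ) (L : List (Fin n)) (hi : i ∉ L) :
    (uninformedSearch n M μ c).buyProb i p m k L = 0 := by
  have hn : 0 < n := i.pos
  have hij' : (p j : ℝ) < p i := by exact_mod_cast hij
  induction k generalizing L with
  | zero => exact (uninformedSearch n M μ c).buy_unvisited p L m i hi
  | succ k ih =>
    have hvisit : (uninformedSearch n M μ c).visit p L m i = 0 := by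
      rcases indexStrategy_cases (M := M) (v := fun _ q _ => μ - q) (U := fun _ q => μ - c - q)
        (hv := fun _ => by fun_prop) (hU := fun _ => by fun_prop) hn p L m with
        ⟨-, hvis, -⟩ | ⟨l, -, hl, ⟨-, hvis, -⟩ | ⟨hlL, hvis, -⟩⟩
      · exact congrFun hvis i
      · exact congrFun hvis i
      · refine (congrFun hvis i).trans (Pi.single_eq_of_ne ?_ _)
        rintro rfl
        have := hl j
        simp only [searchIndex, hi, if_false] at this
        -- Visited or not, the cheaper firm `j` has index at least `μ - c - p j`, above that of the
        -- unvisited `i`.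
        split_ifs at this <;> linarith
    simp only [SearchStrategy.buyProb]
    rw [(uninformedSearch n M μ c).buy_unvisited p L m i hi, zero_add]
    refine Finset.sum_eq_zero fun l _ => ?_
    by_cases hl : l = i
    · rw [hl, hvisit, zero_mul]
    · rw [ih (l :: L) (by simp [hi, Ne.symm hl]), mul_zero]

end Babbling

/-! ### The babbling equilibrium. -/

section Existence

variable {n : ℕ} {M : Type*} [MeasurableSpace M] {μ c : ℝ}

/-- All firms post price 0 and always send the message `a`, and beliefs never move. -/
def babblingAssessment (n : ℕ) (hμ : μ ∈ Set.Icc (0 : ℝ) 1) (c : ℝ) (a : M) :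
    SymmetricAssessment n M where
  priceLaw := Measure.dirac 0
  isProb_priceLaw := inferInstance
  message := Kernel.const _ (Measure.dirac a)
  isMarkov_message := inferInstance
  conj _ := Kernel.const _ (Measure.dirac a)
  isMarkov_conj _ := inferInstance
  belief _ _ _ := μ
  belief_mem _ _ _ := hμ
  measurable_belief _ := measurable_const
  search := uninformedSearch n M μ c

lemma isEquilibrium_babblingAssessment (hn : 2 ≤ n) (hμ : μ ∈ Set.Icc (0 : ℝ) 1) (hc : 0 ≤ c)
    (a : M) : (babblingAssessment n hμ c a).IsEquilibrium μ c := by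
  have hfact : Fact (0 ≤ μ ∧ μ ≤ 1) := ⟨hμ⟩
  have hlaw : ∀ (i : Fin n) (q : ℝ≥0),
      messageLaw μ ((babblingAssessment n hμ c a).conj i) q = Measure.dirac a := by
    intro i q
    simp [messageLaw, babblingAssessment, ← add_smul, ofReal_add_ofReal_one_sub hμ.1 hμ.2]
  have hprob : ∀ (i : Fin n) (q : ℝ≥0),
      IsProbabilityMeasure (messageLaw μ ((babblingAssessment n hμ c a).conj i) q) :=
    fun i q => by rw [hlaw]; infer_instance
  refine ⟨fun i => .of_forall fun q x => rfl, fun i q S hS => ?_, fun t p L m hL => ?_,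
    fun i x q b => ?_⟩
  · rw [hlaw]
    simp only [babblingAssessment, setIntegral_const, Kernel.const_apply, smul_eq_mul]
    ring
  · have hlen : L.length ≤ n := by simpa using hL.length_le_card
    refine (t.payoff_le_uninformedValue hc p _ L m).trans ?_
    exact (payoff_uninformedSearch (by omega) hc p _ L hL (by omega) m).ge
  · rcases eq_or_ne q 0 with rfl | hq
    · simp
    -- Some rival charges `0`, so a firm with a positive price is never visited; deviations earn
    -- nothing.
    have hsale : (babblingAssessment n hμ c a).saleProb μ i q b = 0 := by
      refine (lintegral_congr_ae ?_).trans lintegral_zero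
      obtain ⟨j, hj⟩ : ∃ j : Fin n, j ≠ i := by
        have : Nontrivial (Fin n) := Fin.nontrivial_iff_two_le.2 hn
        exact exists_ne i
      have hzero : ∀ᵐ z ∂(babblingAssessment n hμ c a).playLaw μ, z.1 = 0 := by
        rw [SymmetricAssessment.playLaw_eq_compProd, Measure.ae_compProd_iff
          (measurableSet_eq_fun measurable_fst measurable_const)]
        change ∀ᵐ q ∂Measure.dirac (0 : ℝ≥0), _
        rw [ae_dirac_eq, Filter.eventually_pure]
        exact .of_forall fun _ => rfl
      filter_upwards [(Measure.quasiMeasurePreserving_eval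
        (fun _ : Fin n => (babblingAssessment n hμ c a).playLaw μ) j).ae hzero] with ω hω
      have hω' : (ω j).1 = 0 := hω
      have := buyProb_uninformedSearch_eq_zero (μ := μ) (M := M)
        (p := Function.update (fun k => (ω k).1) i q) (i := i) (j := j) hc
        (by simpa [hj, hω'] using pos_iff_ne_zero.2 hq)
        (Function.update (fun k => (ω k).2) i b) n [] List.not_mem_nil
      exact_mod_cast this
    rw [hsale, mul_zero]
    exact zero_le

end Existence

end

theorem proposition2 {n : ℕ} (hn : 2 ≤ n) {M : Type*} [MeasurableSpace M] [Nonempty M]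
    {μ c : ℝ} (hμ0 : 0 < μ) (hμ1 : μ < 1) (hc0 : 0 ≤ c) (hcμ : c < μ) :
    (∃ A : SymmetricAssessment n M, A.IsEquilibrium μ c) ∧
    ∀ A : SymmetricAssessment n M, A.IsEquilibrium μ c →
      A.priceLaw = Measure.dirac 0 ∧
      ∀ i : Fin n,
        UselessInformation μ c (A.posteriorLaw μ i 0) ∧
        IsReservationValue c (A.posteriorLaw μ i 0) 0 (μ - c) ∧
        ∀ U : ℝ, IsReservationValue c (A.posteriorLaw μ i 0) 0 U →
          effectiveLaw (A.posteriorLaw μ i 0) 0 U = Measure.dirac (μ - c) := by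
  refine ⟨?_, fun A hA => ?_⟩
  · obtain ⟨a⟩ := ‹Nonempty M›
    exact ⟨_, isEquilibrium_babblingAssessment hn ⟨hμ0.le, hμ1.le⟩ hc0 a⟩
  · have hfact : Fact (0 ≤ μ ∧ μ ≤ 1) := ⟨hμ0.le, hμ1.le⟩
    refine ⟨hA.priceLaw_eq_dirac hc0 hn hcμ, fun i => ?_⟩
    obtain ⟨hF, hmem, hmean⟩ := hA.ae_posteriorLaw_mem hc0 hn hcμ i
    exact ⟨uselessInformation_of_ae hmem, isReservationValue_of_ae hmem hmean,
      fun U hU => effectiveLaw_eq_dirac_of_ae hmem hmean hU⟩
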